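/- Let $R$ be a ring. A coloured poset $(P,\mathcal F)$ is a poset $P$ with a greatest element $1=1_P$ together with a covariant functor $\mathcal F:P\to \mathrm{Mod}_R$. A morphism $(P_1,\mathcal F_1)\to(P_2,\mathcal F_2)$ is a pair $(f,\tau)$ of an order-preserving map $f:P_1\to P_2$ with $f(x)=1$ if and only if $x=1$, and $R$-linear maps $\tau_x:\mathcal F_1(x)\to\mathcal F_2(f(x))$ with $\tau_y\circ\mathcal F_1(x\le y)=\mathcal F_2(f(x)\le f(y))\circ\tau_x$ for $x\le y$. This gives a category $\mathcal{CP}_R$. The homology $H_*(P,\mathcal F)$ is that of the chain complex $\mathcal S_*(P,\mathcal F)$ with $\mathcal S_0=\mathcal F(1)$ and, for $k>0$, $\mathcal S_k=\bigoplus_{x_1\le\cdots\le x_k,\ x_i\in P\setminus 1}\mathcal F(x_1)$, with $d_1(\lambda x)=\mathcal F(x\le 1)(\lambda)$ and $$d_k(\lambda x_1\cdots x_k)=\mathcal F(x_1\le x_2)(\lambda)\,x_2\cdots x_k-\sum_{i=2}^k(-1)^i\lambda\, x_1\cdots\widehat{x_i}\cdots x_k\qquad(k>1).$$ It is functorial: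 $(f,\tau)$ induces $\lambda x_1\cdots x_k\mapsto\tau_{x_1}(\lambda)f(x_1)\cdots f(x_k)$. A bundle of coloured posets over a poset $B$ with $1$ is a functor $\xi:B\to\mathcal{CP}_R$; write $\xi(x)=(E_x,\mathcal F_x)$ and $\xi(x\le x')=(f_x^{x'},\tau_x^{x'})$. Its total coloured poset $(E,\mathcal F)$ is the disjoint union $E=\bigsqcup_{x\in B}E_x$, where for $y\in E_x$, $y'\in E_{x'}$ one has $y\le y'$ if and only if $x\le x'$ and $f_x^{x'}(y)\le y'$ in $E_{x'}$, with colouring $\mathcal F(y)=\mathcal F_x(y)$ and $\mathcal F(y\le y')=\mathcal F_{x'}(f_x^{x'}(y)\le y')\circ(\tau_x^{x'})_y$. Let $\mathcal H^{\mathrm{fib}}_q(\xi)=H_q\circ\xi$ be the colouring of $B$ by the $q$-th homology of the fibres. For $x\in P$ let $P(x)=\{y\in P\mid y\le x\}$ and $\overline P(x)=\{y\in P\mid y\not\le x\}$. A poset $P$ with $1$ is admissible for $x$ if $1$ covers $x$ and, for every $y<x$, the set $\{z\in\overline P(x)\mid y\le z\}$ has a unique minimal element, and this element is not $1$. The class of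 specially admissible posets is the smallest class of posets with $1$ that contains the two-element chain $0<1$ and contains $P$ whenever $P$ is admissible for some $x$ such that $P(x)$ and $\overline P(x)$ are in the class. **Theorem.** Let $\xi:B\to\mathcal{CP}_R$ be a bundle of coloured posets with $B$ finite and specially admissible, and let $(E,\mathcal F)$ be its total coloured poset. Then there is a first quadrant homological spectral sequence of $R$-modules $(E^r_{p,q},d^r)_{r\ge 2}$, with $d^r:E^r_{p,q}\to E^r_{p-r,q+r-1}$, such that $$E^2_{p,q}\cong H_p(B,\mathcal H^{\mathrm{fib}}_q(\xi))\Longrightarrow H_{p+q}(E,\mathcal F).$$ That is, each $H_n(E,\mathcal F)$ has a filtration $0=F_{-1}\subseteq F_0\subseteq\cdots\subseteq F_n=H_n(E,\mathcal F)$ such that, for all $p,q\ge 0$ and all sufficiently large $r$ (depending on $p,q$), the differentials into and out of $E^r_{p,q}$ vanish and $E^r_{p,q}\cong F_pH_{p+q}(E,\mathcal F)/F_{p-1}H_{p+q}(E,\mathcal F)$. -/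

import Mathlib

open CategoryTheory

universe r u

noncomputable section

/-! ### Coloured posets -/

/-- A coloured poset over `R`: a poset `P` with greatest element `1 = ⊤` together with a covariant
functor from `P` to the category of `R`-modules, the colouring. -/
structure ColouredPoset (R : Type r) [Ring R] where
  /-- the underlying set of the poset -/
  carrier : Type u
  [partialOrder : PartialOrder carrier]
  [orderTop : OrderTop carrier]
  /-- the colouring -/
  colour : carrier ⥤ ModuleCat.{u} R

namespace ColouredPoset

variable {R : Type r} [Ring R]

instance : CoeSort (ColouredPoset.{r, u} R) (Type u) := ⟨carrier⟩

attribute [instance] partialOrder orderTop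

/-- The module homomorphism `F(x ≤ y)` of the colouring. -/
abbrev res (P : ColouredPoset.{r, u} R) {x y : P} (h : x ≤ y) :
    P.colour.obj x ⟶ P.colour.obj y :=
  P.colour.map (homOfLE h)

/-- A morphism `(f, τ)` of coloured posets: a map of posets `f` such that `f x = 1` if and only
if `x = 1`, and module homomorphisms `τ_x : F₁(x) ⟶ F₂(f x)` compatible with the colourings. -/
structure Hom (P Q : ColouredPoset.{r, u} R) where
  /-- the map of posets -/
  toOrderHom : P →o Q
  eq_top_iff : ∀ x, toOrderHom x = ⊤ ↔ x = ⊤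
  /-- the module homomorphisms -/
  app : ∀ x, P.colour.obj x ⟶ Q.colour.obj (toOrderHom x)
  naturality : ∀ {x y : P} (h : x ≤ y),
    P.res h ≫ app y = app x ≫ Q.res (toOrderHom.monotone h)

/-- Coloured posets and their morphisms form a category. -/
instance : Category (ColouredPoset.{r, u} R) where
  Hom := Hom
  id P :=
    { toOrderHom := OrderHom.id
      eq_top_iff := fun _ => Iff.rfl
      app := fun _ => 𝟙 _
      naturality := fun _ => (Category.comp_id _).trans (Category.id_comp _).symm }
  comp φ ψ :=
    { toOrderHom := ψ.toOrderHom.comp φ.toOrderHom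
      eq_top_iff := fun x => (ψ.eq_top_iff _).trans (φ.eq_top_iff x)
      app := fun x => φ.app x ≫ ψ.app (φ.toOrderHom x)
      naturality := fun {x y} h => by
        have h₁ := φ.naturality h =≫ ψ.app (φ.toOrderHom y)
        have h₂ := φ.app x ≫= ψ.naturality (φ.toOrderHom.monotone h)
        rw [Category.assoc, Category.assoc] at h₁
        exact (h₁.trans h₂).trans (Category.assoc _ _ _).symm }

@[simp]
lemma id_toOrderHom (P : ColouredPoset.{r, u} R) (x : P) : Hom.toOrderHom (𝟙 P) x = x := rfl

@[simp]
lemma id_app (P : ColouredPoset.{r, u} R) (x : P) : Hom.app (𝟙 P) x = 𝟙 (P.colour.obj x) := rfl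

@[simp]
lemma comp_toOrderHom {P Q S : ColouredPoset.{r, u} R} (φ : P ⟶ Q) (ψ : Q ⟶ S) (x : P) :
    Hom.toOrderHom (φ ≫ ψ) x = Hom.toOrderHom ψ (Hom.toOrderHom φ x) := rfl

@[simp]
lemma comp_app {P Q S : ColouredPoset.{r, u} R} (φ : P ⟶ Q) (ψ : Q ⟶ S) (x : P) :
    Hom.app (φ ≫ ψ) x = Hom.app φ x ≫ Hom.app ψ (Hom.toOrderHom φ x) := rfl

/-- Equal morphisms have equal underlying maps and equal homomorphisms of colours, the latter
after composition into a common target. -/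
lemma Hom.congr_app_res {P Q : ColouredPoset.{r, u} R} {φ ψ : P ⟶ Q} (e : φ = ψ) {x : P} {z : Q}
    (h : Hom.toOrderHom φ x ≤ z) :
    Hom.app φ x ≫ Q.res h =
      Hom.app ψ x ≫ Q.res (show Hom.toOrderHom ψ x ≤ z from e ▸ h) := by
  subst e
  rfl

lemma res_refl (P : ColouredPoset.{r, u} R) {x : P} (h : x ≤ x) : P.res h = 𝟙 _ :=
  P.colour.map_id x

lemma res_comp (P : ColouredPoset.{r, u} R) {x y z : P} (h : x ≤ y) (h' : y ≤ z) :
    P.res h ≫ P.res h' = P.res (h.trans h') :=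
  (P.colour.map_comp _ _).symm

/-! ### The chain complex and the homology of a coloured poset -/

/-- The subposet `P \ 1`. -/
abbrev Proper (P : ColouredPoset.{r, u} R) : Type u := {x : P // x ≠ ⊤}

/-- The map `P \ 1 → Q \ 1` induced by a morphism of coloured posets. -/
def Hom.proper {P Q : ColouredPoset.{r, u} R} (φ : P ⟶ Q) : P.Proper →o Q.Proper where
  toFun x := ⟨Hom.toOrderHom φ x.1, fun h => x.2 ((Hom.eq_top_iff φ x.1).1 h)⟩
  monotone' _ _ h := (Hom.toOrderHom φ).monotone h

open scoped DirectSum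

open Classical in
/-- The direct sum of the modules `F(x₀)` over all multi-sequences `x₀ ≤ ⋯ ≤ xₙ` in `P \ 1`. -/
abbrev Simplices (P : ColouredPoset.{r, u} R) (n : ℕ) : Type u :=
  ⨁ s : Fin (n + 1) →o P.Proper, P.colour.obj (s 0).1

open Classical in
/-- The element `λ x₀ ⋯ xₙ` of the direct sum, as a linear function of `λ ∈ F(x₀)`. -/
def single (P : ColouredPoset.{r, u} R) {n : ℕ} (s : Fin (n + 1) →o P.Proper) :
    P.colour.obj (s 0).1 →ₗ[R] P.Simplices n :=
  DirectSum.lof R (Fin (n + 1) →o P.Proper) (fun s => P.colour.obj (s 0).1) s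

open Classical in
/-- The linear map on the direct sum with prescribed restrictions to the summands. -/
def lift (P : ColouredPoset.{r, u} R) {n : ℕ} {M : Type u} [AddCommGroup M] [Module R M]
    (g : ∀ s : Fin (n + 1) →o P.Proper, P.colour.obj (s 0).1 →ₗ[R] M) :
    P.Simplices n →ₗ[R] M :=
  DirectSum.toModule R _ M g

@[simp]
lemma lift_single (P : ColouredPoset.{r, u} R) {n : ℕ} {M : Type u} [AddCommGroup M] [Module R M]
    (g : ∀ s : Fin (n + 1) →o P.Proper, P.colour.obj (s 0).1 →ₗ[R] M)
    (s : Fin (n + 1) →o P.Proper) (v : P.colour.obj (s 0).1) :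
    P.lift g (P.single s v) = g s v := by
  classical
  unfold lift single
  exact DirectSum.toModule_lof (φ := g) R s v

lemma hom_ext_single {P : ColouredPoset.{r, u} R} {n : ℕ} {M : Type u} [AddCommGroup M]
    [Module R M] {g g' : P.Simplices n →ₗ[R] M}
    (h : ∀ s v, g (P.single s v) = g' (P.single s v)) : g = g' := by
  classical
  exact DirectSum.linearMap_ext R fun s => LinearMap.ext (h s)

/-- The map `λ x₀ ⋯ xₙ ↦ F(x₀ ≤ x_{θ(0)})(λ) x_{θ(0)} ⋯ x_{θ(m)}` of direct sums induced by a
monotone map `θ`. -/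
def operator (P : ColouredPoset.{r, u} R) {m n : ℕ} (θ : Fin (m + 1) →o Fin (n + 1)) :
    P.Simplices n →ₗ[R] P.Simplices m :=
  P.lift fun s => P.single (s.comp θ) ∘ₗ
    (P.res (show (s 0).1 ≤ (s (θ 0)).1 from s.monotone (Fin.zero_le _))).hom

lemma operator_single (P : ColouredPoset.{r, u} R) {m n : ℕ} (θ : Fin (m + 1) →o Fin (n + 1))
    (s : Fin (n + 1) →o P.Proper) (v : P.colour.obj (s 0).1) :
    P.operator θ (P.single s v) = P.single (s.comp θ)
      ((P.res (show (s 0).1 ≤ (s (θ 0)).1 from s.monotone (Fin.zero_le _))).hom v) :=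
  P.lift_single _ s v

lemma operator_id (P : ColouredPoset.{r, u} R) {n : ℕ} :
    P.operator (OrderHom.id : Fin (n + 1) →o Fin (n + 1)) = LinearMap.id := by
  refine hom_ext_single fun s v => ?_
  refine (P.operator_single OrderHom.id s v).trans ?_
  have h : (P.res (le_refl (s 0).1)).hom v = v :=
    congrArg (fun k => ModuleCat.Hom.hom k v) (P.res_refl (le_refl (s 0).1))
  exact congrArg (P.single s) h

/-- The simplicial module whose module of `n`-simplices is the direct sum of the modules `F(x₀)`
over all multi-sequences `x₀ ≤ ⋯ ≤ xₙ` in `P \ 1`. -/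
def simplicialModule (P : ColouredPoset.{r, u} R) : SimplicialObject (ModuleCat.{u} R) where
  obj Δ := ModuleCat.of R (P.Simplices Δ.unop.len)
  map θ := ModuleCat.ofHom (P.operator θ.unop.toOrderHom)
  map_id Δ := by
    ext1
    exact P.operator_id
  map_comp θ θ' := by
    ext1
    refine hom_ext_single fun s v => ?_
    refine (P.operator_single _ s v).trans ?_
    refine Eq.trans ?_ (congrArg (P.operator θ'.unop.toOrderHom)
      (P.operator_single θ.unop.toOrderHom s v)).symm
    refine Eq.trans ?_ (P.operator_single _ _ _).symm
    exact congrArg (P.single _) (congrArg (fun k => ModuleCat.Hom.hom k v) (P.res_comp _ _).symm)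

/-- The map `λ x₀ ⋯ xₙ ↦ τ_{x₀}(λ) f(x₀) ⋯ f(xₙ)` of direct sums induced by a morphism `(f, τ)` of
coloured posets. -/
def simplicesMap {P Q : ColouredPoset.{r, u} R} (φ : P ⟶ Q) (n : ℕ) :
    P.Simplices n →ₗ[R] Q.Simplices n :=
  P.lift fun s => Q.single ((Hom.proper φ).comp s) ∘ₗ (Hom.app φ (s 0).1).hom

lemma simplicesMap_single {P Q : ColouredPoset.{r, u} R} (φ : P ⟶ Q) {n : ℕ}
    (s : Fin (n + 1) →o P.Proper) (v : P.colour.obj (s 0).1) :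
    simplicesMap φ n (P.single s v) =
      Q.single ((Hom.proper φ).comp s) ((Hom.app φ (s 0).1).hom v) :=
  P.lift_single _ s v

/-- The map of simplicial modules induced by a morphism of coloured posets. -/
def simplicialModuleMap {P Q : ColouredPoset.{r, u} R} (φ : P ⟶ Q) :
    P.simplicialModule ⟶ Q.simplicialModule where
  app Δ := ModuleCat.ofHom (simplicesMap φ Δ.unop.len)
  naturality Δ Δ' θ := by
    ext1
    refine hom_ext_single fun s v => ?_
    refine (congrArg (simplicesMap φ _) (P.operator_single θ.unop.toOrderHom s v)).trans ?_
    refine (simplicesMap_single φ _ _).trans ?_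
    refine Eq.trans ?_ (congrArg (Q.operator θ.unop.toOrderHom) (simplicesMap_single φ s v)).symm
    refine Eq.trans ?_ (Q.operator_single _ _ _).symm
    exact congrArg (Q.single _) (congrArg (fun k => ModuleCat.Hom.hom k v)
      (Hom.naturality φ (show (s 0).1 ≤ (s (θ.unop.toOrderHom 0)).1 from
        s.monotone (Fin.zero_le _))))

/-- The unaugmented complex, with `k`-chains indexed by `x₀ ≤ ⋯ ≤ x_k`. -/
abbrev unaugmented (P : ColouredPoset.{r, u} R) : ChainComplex (ModuleCat.{u} R) ℕ :=
  (AlgebraicTopology.alternatingFaceMapComplex (ModuleCat.{u} R)).obj P.simplicialModule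

/-- The augmentation `λ x ↦ F(x ≤ 1)(λ)`. -/
def augmentation (P : ColouredPoset.{r, u} R) : P.unaugmented.X 0 ⟶ P.colour.obj ⊤ :=
  ModuleCat.ofHom <| P.lift (n := 0) fun s => (P.res (le_top : (s 0).1 ≤ ⊤)).hom

lemma augmentation_single (P : ColouredPoset.{r, u} R) (s : Fin 1 →o P.Proper)
    (v : P.colour.obj (s 0).1) :
    P.augmentation.hom (P.single (n := 0) s v) = (P.res (le_top : (s 0).1 ≤ ⊤)).hom v :=
  P.lift_single (n := 0) _ s v

lemma operator_comp_augmentation (P : ColouredPoset.{r, u} R) (θ : Fin 1 →o Fin 2) :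
    ModuleCat.ofHom (P.operator (m := 0) (n := 1) θ) ≫ P.augmentation =
      ModuleCat.ofHom (P.lift (n := 1) fun s => (P.res (le_top : (s 0).1 ≤ ⊤)).hom) := by
  ext1
  refine hom_ext_single (n := 1) fun s v => ?_
  refine (congrArg P.augmentation.hom (P.operator_single (m := 0) (n := 1) θ s v)).trans ?_
  refine (P.augmentation_single _ _).trans ?_
  refine Eq.trans ?_ (P.lift_single (n := 1) _ s v).symm
  exact congrArg (fun k => ModuleCat.Hom.hom k v) (P.res_comp _ _)

lemma d_comp_augmentation (P : ColouredPoset.{r, u} R) :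
    P.unaugmented.d 1 0 ≫ P.augmentation = 0 := by
  rw [AlgebraicTopology.alternatingFaceMapComplex_obj_d,
    AlgebraicTopology.AlternatingFaceMapComplex.objD, Fin.sum_univ_two]
  simp only [Fin.val_zero, pow_zero, one_smul, Fin.val_one, pow_one, neg_smul,
    Preadditive.add_comp, Preadditive.neg_comp]
  exact (add_neg_eq_zero).2 ((P.operator_comp_augmentation _).trans
    (P.operator_comp_augmentation _).symm)

/-- The chain complex `S_*(P, F)`: in degree `0` it is `F(1)`, in degree `k > 0` it is the direct
sum of the modules `F(x₁)` over all multi-sequences `x₁ ≤ ⋯ ≤ x_k` in `P \ 1`, and the differential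
is the alternating sum of the maps which omit `xᵢ` (starting with `+` for `i = 1`), where `x₁` is
omitted by means of `F(x₁ ≤ x₂)`, respectively of `F(x₁ ≤ 1)` when `k = 1`. -/
def chainComplex (P : ColouredPoset.{r, u} R) : ChainComplex (ModuleCat.{u} R) ℕ :=
  P.unaugmented.augment P.augmentation P.d_comp_augmentation

/-- The chain map induced by a morphism `(f, τ)` of coloured posets, with
`λ x₁ ⋯ x_k ↦ τ_{x₁}(λ) f(x₁) ⋯ f(x_k)`. In degree `0` it is `τ₁`, recalling that `f 1 = 1`. -/
def chainMap {P Q : ColouredPoset.{r, u} R} (φ : P ⟶ Q) : P.chainComplex ⟶ Q.chainComplex where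
  f
    | 0 => Hom.app φ ⊤ ≫ Q.res le_top
    | k + 1 => ((AlgebraicTopology.alternatingFaceMapComplex (ModuleCat.{u} R)).map
        (simplicialModuleMap φ)).f k
  comm' := by
    rintro i j (rfl : j + 1 = i)
    cases j with
    | zero =>
      ext1
      refine hom_ext_single (n := 0) fun s v => ?_
      refine (congrArg Q.augmentation.hom (simplicesMap_single φ (n := 0) s v)).trans ?_
      refine (Q.augmentation_single _ _).trans ?_
      refine Eq.trans ?_ (congrArg (Hom.app φ ⊤ ≫ Q.res le_top).hom
        (P.augmentation_single s v)).symm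
      have h := congrArg (fun k => ModuleCat.Hom.hom k v)
        (Hom.naturality φ (le_top : (s 0).1 ≤ ⊤) =≫ Q.res le_top)
      refine Eq.trans ?_ h.symm
      exact congrArg (fun k => ModuleCat.Hom.hom k ((Hom.app φ (s 0).1).hom v))
        (Q.res_comp _ _).symm
    | succ j =>
      exact ((AlgebraicTopology.alternatingFaceMapComplex (ModuleCat.{u} R)).map
        (simplicialModuleMap φ)).comm (j + 1) j

/-- The functor `S_*` from coloured posets to chain complexes of modules. -/
def chains (R : Type r) [Ring R] :
    ColouredPoset.{r, u} R ⥤ ChainComplex (ModuleCat.{u} R) ℕ where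
  obj P := P.chainComplex
  map φ := chainMap φ
  map_id P := by
    refine HomologicalComplex.hom_ext _ _ fun k => ?_
    cases k with
    | zero => exact (Category.id_comp _).trans (P.res_refl _)
    | succ k =>
      ext1
      exact hom_ext_single fun s v => simplicesMap_single (𝟙 P) s v
  map_comp {P Q S} φ ψ := by
    refine HomologicalComplex.hom_ext _ _ fun k => ?_
    cases k with
    | zero =>
      ext1
      ext v
      have h := congrArg (fun k => ModuleCat.Hom.hom k ((Hom.app φ ⊤).hom v))
        (Hom.naturality ψ (le_top : Hom.toOrderHom φ ⊤ ≤ ⊤) =≫ S.res le_top)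
      refine Eq.trans ?_ h.symm
      exact congrArg (fun k => ModuleCat.Hom.hom k ((Hom.app ψ _).hom ((Hom.app φ ⊤).hom v)))
        (S.res_comp _ _).symm
    | succ k =>
      ext1
      refine hom_ext_single fun s v => ?_
      refine (simplicesMap_single (φ ≫ ψ) s v).trans ?_
      refine Eq.trans ?_ (congrArg (simplicesMap ψ k) (simplicesMap_single φ s v)).symm
      exact (simplicesMap_single ψ ((Hom.proper φ).comp s) ((Hom.app φ (s 0).1).hom v)).symm

/-- The homology functor `H_n` of coloured posets. -/
def homology (R : Type r) [Ring R] (n : ℕ) : ColouredPoset.{r, u} R ⥤ ModuleCat.{u} R :=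
  chains R ⋙ HomologicalComplex.homologyFunctor (ModuleCat.{u} R) (ComplexShape.down ℕ) n

end ColouredPoset

/-! ### Bundles of coloured posets -/

/-- A bundle of coloured posets with base a poset `B` with `1`: a functor from `B` to coloured
posets. -/
abbrev ColouredPosetBundle (R : Type r) [Ring R] (B : Type u) [PartialOrder B] [OrderTop B] :=
  B ⥤ ColouredPoset.{r, u} R

namespace ColouredPosetBundle

open ColouredPoset

variable {R : Type r} [Ring R] {B : Type u} [PartialOrder B] [OrderTop B]

/-- The morphism `(f_x^z, τ_x^z)` from the fibre over `x` to the fibre over `z`. -/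
abbrev trans (ξ : ColouredPosetBundle R B) {x z : B} (h : x ≤ z) : ξ.obj x ⟶ ξ.obj z :=
  ξ.map (homOfLE h)

/-- The disjoint union of the fibres of a bundle. -/
@[ext]
structure Total (ξ : ColouredPosetBundle R B) where
  /-- the projection to the base -/
  base : B
  /-- the element of the fibre -/
  pt : ξ.obj base

lemma trans_refl (ξ : ColouredPosetBundle R B) {x : B} (h : x ≤ x) : ξ.trans h = 𝟙 _ :=
  ξ.map_id x

lemma trans_comp (ξ : ColouredPosetBundle R B) {x y z : B} (h : x ≤ y) (h' : y ≤ z) :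
    ξ.trans h ≫ ξ.trans h' = ξ.trans (h.trans h') :=
  (ξ.map_comp _ _).symm

lemma trans_refl_apply (ξ : ColouredPosetBundle R B) {x : B} (h : x ≤ x) (y : ξ.obj x) :
    Hom.toOrderHom (ξ.trans h) y = y := by
  rw [ξ.trans_refl]
  rfl

lemma trans_trans_apply (ξ : ColouredPosetBundle R B) {x y z : B} (h : x ≤ y) (h' : y ≤ z)
    (w : ξ.obj x) : Hom.toOrderHom (ξ.trans h') (Hom.toOrderHom (ξ.trans h) w) =
      Hom.toOrderHom (ξ.trans (h.trans h')) w := by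
  rw [← ξ.trans_comp h h']
  rfl

/-- The order on the total poset: for `y` in the fibre over `x` and `y'` in the fibre over `x'`,
`y ≤ y'` if and only if `x ≤ x'` and `f_x^{x'}(y) ≤ y'`. If `x = x'` this is the order of the
fibre, since `f_x^x` is the identity. -/
instance (ξ : ColouredPosetBundle R B) : PartialOrder (Total ξ) where
  le a b := ∃ h : a.base ≤ b.base, Hom.toOrderHom (ξ.trans h) a.pt ≤ b.pt
  le_refl a := ⟨le_rfl, (ξ.trans_refl_apply _ _).le⟩
  le_trans a b c hab hbc := by
    obtain ⟨h, hab⟩ := hab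
    obtain ⟨h', hbc⟩ := hbc
    refine ⟨h.trans h', ?_⟩
    rw [← ξ.trans_trans_apply h h']
    exact ((Hom.toOrderHom (ξ.trans h')).monotone hab).trans hbc
  le_antisymm a b hab hba := by
    obtain ⟨x, y⟩ := a
    obtain ⟨x', y'⟩ := b
    obtain ⟨h, hab⟩ := hab
    obtain ⟨h', hba⟩ := hba
    obtain rfl : x = x' := le_antisymm h h'
    rw [ξ.trans_refl_apply] at hab hba
    exact congrArg _ (le_antisymm hab hba)

/-- The greatest element of the total poset is the greatest element of the fibre over `1`. -/
instance (ξ : ColouredPosetBundle R B) : OrderTop (Total ξ) where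
  top := ⟨⊤, ⊤⟩
  le_top _ := ⟨le_top, le_top⟩

/-- The total coloured poset `(E, F)` of a bundle. For `y` in the fibre over `x` and `y'` in the
fibre over `x'` with `y ≤ y'`, the homomorphism `F(y ≤ y')` is `F_{x'}(f_x^{x'}(y) ≤ y')` after
`(τ_x^{x'})_y`. If `x = x'` this is `F_x(y ≤ y')`, since `τ_x^x` is the identity. -/
def total (ξ : ColouredPosetBundle R B) : ColouredPoset.{r, u} R where
  carrier := Total ξ
  colour :=
    { obj := fun a => (ξ.obj a.base).colour.obj a.pt
      map := fun {a b} i =>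
        Hom.app (ξ.trans i.le.choose) a.pt ≫ (ξ.obj b.base).res i.le.choose_spec
      map_id := fun a => by
        refine (Hom.congr_app_res (ξ.trans_refl _) _).trans ?_
        exact (Category.id_comp _).trans (res_refl _ _)
      map_comp := fun {a b c} i j => by
        refine (Hom.congr_app_res (ξ.trans_comp i.le.choose j.le.choose).symm _).trans ?_
        ext v
        have h := congrArg (fun k => ModuleCat.Hom.hom k ((Hom.app (ξ.trans i.le.choose) a.pt).hom v))
          (Hom.naturality (ξ.trans j.le.choose) i.le.choose_spec =≫
            (ξ.obj c.base).res j.le.choose_spec)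
        refine Eq.trans ?_ h.symm
        exact congrArg (fun k => ModuleCat.Hom.hom k
          ((Hom.app (ξ.trans j.le.choose) _).hom ((Hom.app (ξ.trans i.le.choose) a.pt).hom v)))
          (res_comp _ _ _).symm }

/-- The colouring of the base by the `q`-th homology of the fibres. -/
def fibreHomology (ξ : ColouredPosetBundle R B) (q : ℕ) : ColouredPoset.{r, u} R where
  carrier := B
  colour := ξ ⋙ homology R q

end ColouredPosetBundle

/-! ### Specially admissible posets -/

/-- A poset `P` with `1` is admissible by means of `x` if `1` covers `x` and, for all `y < x`, the
subposet `L(y) = {z | ¬ z ≤ x, y ≤ z}` has a unique minimal element, which is not `1`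
(the poset with a single element has by convention no `0`). -/
def IsAdmissibleAt {P : Type u} [PartialOrder P] [OrderTop P] (x : P) : Prop :=
  x ⋖ ⊤ ∧ ∀ y, y < x → ∃ m, m ≠ ⊤ ∧ ∀ z, Minimal (fun w => ¬ w ≤ x ∧ y ≤ w) z ↔ z = m

/-- The complement of the interval below `x` contains `1`, if `x` is not `1`. -/
abbrev orderTopNotLE {P : Type u} [PartialOrder P] [OrderTop P] (x : P) (hx : x < ⊤) :
    OrderTop {y : P // ¬ y ≤ x} where
  top := ⟨⊤, hx.not_ge⟩
  le_top _ := Subtype.coe_le_coe.1 le_top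

/-- A poset with `1` is specially admissible if it is Boolean of rank one, or if it is admissible
by means of some `x` for which the interval `{y | y ≤ x}` and its complement `{y | ¬ y ≤ x}` are
specially admissible. -/
inductive IsSpeciallyAdmissible : (P : Type u) → [PartialOrder P] → [OrderTop P] → Prop
  | rankOne {P : Type u} [PartialOrder P] [OrderTop P] (e : P ≃o Bool) : IsSpeciallyAdmissible P
  | split {P : Type u} [PartialOrder P] [OrderTop P] (x : P) (hx : IsAdmissibleAt x)
      (hle : IsSpeciallyAdmissible (Set.Iic x))
      (hnle : @IsSpeciallyAdmissible {y : P // ¬ y ≤ x} _ (orderTopNotLE x hx.1.lt)) :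
      IsSpeciallyAdmissible P

/-! ### Convergence of spectral sequences -/

/-- First quadrant homological spectral sequences of `R`-modules starting with the second page:
for every `r ≥ 2` a page `(E^r_{p,q})` with differentials
`d^r : E^r_{p,q} ⟶ E^r_{p-r,q+r-1}`, whose homology is identified with the next page. -/
abbrev HomologicalSpectralSequence (R : Type r) [Ring R] :=
  SpectralSequence (ModuleCat.{u} R)
    (fun k : ℤ => ComplexShape.spectralSequenceNat ((-k, k - 1) : ℤ × ℤ)) 2

/-- Convergence of a first quadrant spectral sequence to a graded module `H`: there are filtrations
`0 = F_{-1} H_n ≤ F_0 H_n ≤ ⋯ ≤ F_n H_n = H_n` such that, for all `p, q`, the differentials into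
and out of `E^k_{p,q}` vanish for all large `k`, and this stable term is isomorphic to
`F_p H_{p+q} / F_{p-1} H_{p+q}`. -/
def HomologicalSpectralSequence.ConvergesTo {R : Type r} [Ring R]
    (E : HomologicalSpectralSequence.{r, u} R) (H : ℕ → ModuleCat.{u} R) : Prop :=
  ∃ F : (n : ℕ) → ℤ → Submodule R (H n),
    (∀ n, Monotone (F n)) ∧ (∀ n, F n (-1) = ⊥) ∧ (∀ n, F n n = ⊤) ∧
    ∀ p q : ℕ, ∃ k₀ : ℤ, ∀ (k : ℤ) (hk : 2 ≤ k), k₀ ≤ k →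
      (∀ a, (E.page k hk).d a (p, q) = 0) ∧ (∀ a, (E.page k hk).d (p, q) a = 0) ∧
      Nonempty ((E.page k hk).X (p, q) ≃ₗ[R]
        (F (p + q) p ⧸ (F (p + q) (p - 1)).submoduleOf (F (p + q) p)))

end

/-! Let K_{p,q} = S_p(B, S_q ∘ ξ) be the chains of the base with coefficients in the chains of the
fibres, and filter its total complex by the canonical truncations of the columns q ↦ K_{p,q}. In
each degree the chains of B are a direct sum of values of the colouring, so S_p(B, -) is exact in
the colouring, and the graded pieces of the filtration have homology H_p(B, H_q^fib)
(`ColouredPoset.quot_equiv_homology`). With this filtration the second page appears at once. A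
filtered complex has a spectral object, and since the filtration is finite in each degree the
spectral sequence converges to the homology of Tot K (`convergesTo`).

It remains to identify H_n(Tot K) with H_n(E, F) (`homology_total_iso`). For this the posets are
kept fixed and the colouring G of E varies. Each G restricts to a bundle with the same posets
(`recolour`), and ξ itself comes from the colouring F. Both sides are homology functors of complexes
which depend exactly on G, so dimension shifting (`homology_iso_of_effaceable`) reduces the
comparison to two facts.

The first is agreement in degree zero. Both sides are the quotient of G(1) by the images of the G(z)
with z ≠ 1, because (x, y) ≤ 1 factors through (x, 1) when x ≠ 1 (`iSup_range_eq_sup`).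

The second is vanishing in positive degrees on direct sums of representable colourings, which cover
every G. For the chains of E, preceding a sequence by the representing element e is a contraction.
For Tot K, the colouring represented by e = (b, y) restricts on the fibre over x ≥ b to the one
represented by f_b^x(y). Its homology is concentrated in degree zero and vanishes unless f_b^x(y) =
1, that is, unless y = 1. So the fibre homology is a direct sum of colourings of B represented by
such b, and the same contraction applies over the base (`isZero_homology_totalComplex_cover`). -/

noncomputable section

/-! ### Linear algebra -/

section LinearAlgebra

variable {R : Type r} [Ring R]

/-- Two quotients of the same module by the same kernel are isomorphic. -/
def LinearMap.equivOfSurjectiveOfKerEq {A B C : Type*} [AddCommGroup A] [AddCommGroup B]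
    [AddCommGroup C] [Module R A] [Module R B] [Module R C] (f : A →ₗ[R] B) (g : A →ₗ[R] C)
    (hf : Function.Surjective f) (hg : Function.Surjective g) (h : ∀ a, f a = 0 ↔ g a = 0) :
    B ≃ₗ[R] C :=
  (f.quotKerEquivOfSurjective hf).symm ≪≫ₗ
    Submodule.quotEquivOfEq (LinearMap.ker f) (LinearMap.ker g) (Submodule.ext fun a => h a) ≪≫ₗ
    g.quotKerEquivOfSurjective hg

lemma LinearMap.equivOfSurjectiveOfKerEq_apply {A B C : Type*} [AddCommGroup A] [AddCommGroup B]
    [AddCommGroup C] [Module R A] [Module R B] [Module R C] (f : A →ₗ[R] B) (g : A →ₗ[R] C)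
    (hf : Function.Surjective f) (hg : Function.Surjective g) (h : ∀ a, f a = 0 ↔ g a = 0)
    (a : A) : LinearMap.equivOfSurjectiveOfKerEq f g hf hg h (f a) = g a := by
  have h1 : (f.quotKerEquivOfSurjective hf).symm (f a) = Submodule.Quotient.mk a := by
    rw [LinearEquiv.symm_apply_eq]
    exact (f.quotKerEquivOfSurjective_apply_mk hf a).symm
  simp only [LinearMap.equivOfSurjectiveOfKerEq, LinearEquiv.trans_apply, h1,
    Submodule.quotEquivOfEq_mk]
  exact g.quotKerEquivOfSurjective_apply_mk hg a

namespace CategoryTheory.ShortComplex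

variable (S : ShortComplex (ModuleCat.{u} R))

/-- The homology class of a family of cycles depending linearly on a parameter. -/
def homologyClass {A : Type u} [AddCommGroup A] [Module R A] (φ : A →ₗ[R] S.X₂)
    (h : ∀ a, S.g (φ a) = 0) : A →ₗ[R] S.homology :=
  (S.liftCycles (ModuleCat.ofHom φ) (by ext a; exact h a) ≫ S.homologyπ).hom

lemma homologyClass_eq_zero_iff {A : Type u} [AddCommGroup A] [Module R A] (φ : A →ₗ[R] S.X₂)
    (h : ∀ a, S.g (φ a) = 0) (a : A) :
    S.homologyClass φ h a = 0 ↔ ∃ x, S.f x = φ a := by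
  have hex := (ShortComplex.moduleCat_exact_iff (ShortComplex.mk S.toCycles S.homologyπ
    S.toCycles_comp_homologyπ)).1
      (ShortComplex.exact_of_g_is_cokernel _ S.homologyIsCokernel)
  have hi : ∀ a, S.iCycles (S.liftCycles (ModuleCat.ofHom φ) (by ext a; exact h a) a) = φ a :=
    fun a => congrArg (fun k => ModuleCat.Hom.hom k a)
      (S.liftCycles_i (ModuleCat.ofHom φ) (by ext a; exact h a))
  have hf : ∀ x, S.iCycles (S.toCycles x) = S.f x := fun x =>
    congrArg (fun k => ModuleCat.Hom.hom k x) S.toCycles_i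
  constructor
  · intro h0
    obtain ⟨x, hx⟩ := hex _ h0
    refine ⟨x, ?_⟩
    rw [← hf, ← hi]
    exact congrArg S.iCycles hx
  · rintro ⟨x, hx⟩
    have hx' : S.toCycles x = S.liftCycles (ModuleCat.ofHom φ) (by ext a; exact h a) a := by
      apply (ModuleCat.mono_iff_injective S.iCycles).1 inferInstance
      rw [hf, hi, hx]
    refine (congrArg S.homologyπ hx').symm.trans ?_
    exact congrArg (fun k => ModuleCat.Hom.hom k x) S.toCycles_comp_homologyπ

lemma homologyClass_surjective {A : Type u} [AddCommGroup A] [Module R A] (φ : A →ₗ[R] S.X₂)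
    (h : ∀ a, S.g (φ a) = 0) (h' : ∀ x, S.g x = 0 → ∃ a y, x = φ a + S.f y) :
    Function.Surjective (S.homologyClass φ h) := by
  intro c
  obtain ⟨z, rfl⟩ := (ModuleCat.epi_iff_surjective S.homologyπ).1 inferInstance c
  have hz : S.g (S.iCycles z) = 0 := congrArg (fun k => ModuleCat.Hom.hom k z) S.iCycles_g
  obtain ⟨a, y, hay⟩ := h' _ hz
  refine ⟨a, ?_⟩
  have : z = S.liftCycles (ModuleCat.ofHom φ) (by ext a; exact h a) a + S.toCycles y := by
    apply (ModuleCat.mono_iff_injective S.iCycles).1 inferInstance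
    rw [map_add, hay]
    congr 1
    · exact (congrArg (fun k => ModuleCat.Hom.hom k a)
        (S.liftCycles_i (ModuleCat.ofHom φ) (by ext a; exact h a))).symm
    · exact (congrArg (fun k => ModuleCat.Hom.hom k y) S.toCycles_i).symm
  rw [this, map_add]
  have h0 : S.homologyπ (S.toCycles y) = 0 :=
    congrArg (fun k => ModuleCat.Hom.hom k y) S.toCycles_comp_homologyπ
  rw [h0, add_zero]
  rfl

/-- The homology of `X₁ ⟶ X₂ ⟶ X₃`, when the kernel of `X₂ ⟶ X₃` is the image of `π : A ⟶ X₂` and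
the image of `X₁ ⟶ X₂` is the image under `π` of the kernel of `v : A ⟶ M`. -/
lemma homology_equiv_quotient {A : Type u} [AddCommGroup A] [Module R A] {M : Type u}
    [AddCommGroup M] [Module R M] (π : A →ₗ[R] S.X₂) (v : A →ₗ[R] M)
    (hπ : ∀ x, S.g x = 0 ↔ ∃ a, π a = x)
    (hv : ∀ x, (∃ y, S.f y = x) ↔ ∃ a, v a = 0 ∧ π a = x) :
    Nonempty (S.homology ≃ₗ[R] (LinearMap.range v ⧸
      ((LinearMap.ker π).map v).submoduleOf (LinearMap.range v))) := by
  have h0 : ∀ a, S.g (π a) = 0 := fun a => (hπ _).2 ⟨a, rfl⟩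
  refine ⟨LinearMap.equivOfSurjectiveOfKerEq (S.homologyClass π h0)
    ((Submodule.mkQ _).comp v.rangeRestrict)
    (S.homologyClass_surjective π h0 fun x hx => ?_)
    ((Submodule.mkQ_surjective _).comp v.surjective_rangeRestrict) fun a => ?_⟩
  · obtain ⟨a, rfl⟩ := (hπ x).1 hx
    exact ⟨a, 0, by simp⟩
  · rw [homologyClass_eq_zero_iff, hv]
    rw [LinearMap.comp_apply, Submodule.mkQ_apply, Submodule.Quotient.mk_eq_zero]
    -- Both conditions say that a is a sum of elements of ker v and ker π. The difference a - b
    -- passes from one form to the other.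
    constructor
    · rintro ⟨b, hb, hab⟩
      refine ⟨a - b, ?_, ?_⟩
      · exact (map_sub π a b).trans (sub_eq_zero.2 hab.symm)
      · exact (map_sub v a b).trans (by rw [hb, sub_zero]; rfl)
    · rintro ⟨b, hb, hab⟩
      have hb' : π b = 0 := hb
      have hab' : v b = v a := hab
      exact ⟨a - b, by rw [map_sub, hab', sub_self], by rw [map_sub, hb', sub_zero]⟩

end CategoryTheory.ShortComplex

end LinearAlgebra

/-! ### Convergence of the spectral sequence of a spectral object -/

namespace CategoryTheory.Abelian.SpectralObject

open ComposableArrows Limits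

variable {R : Type r} [Ring R] (X : SpectralObject (ModuleCat.{u} R) EInt)

/-- The map `H^n(-∞ ≤ i) ⟶ H^n(-∞ ≤ ∞)`. -/
def toAbutment (n : ℤ) (i : EInt) :
    (X.H n).obj (mk₁ (homOfLE (bot_le : (⊥ : EInt) ≤ i))) ⟶
      (X.H n).obj (mk₁ (homOfLE (bot_le : (⊥ : EInt) ≤ ⊤))) :=
  (X.H n).map (twoδ₂Toδ₁ (homOfLE bot_le) (homOfLE (le_top : i ≤ ⊤)) _ rfl)

lemma map_comp_toAbutment (n : ℤ) {i j : EInt} (hij : i ≤ j) :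
    (X.H n).map (twoδ₂Toδ₁ (homOfLE (bot_le : (⊥ : EInt) ≤ i)) (homOfLE hij)
      (homOfLE bot_le) rfl) ≫ X.toAbutment n j = X.toAbutment n i := by
  rw [toAbutment, toAbutment, ← Functor.map_comp]
  congr 1

/-- The limit term `E^n(-∞ ≤ i ≤ j ≤ ∞)` is a subquotient of the abutment. -/
lemma limit_equiv (n₀ n₁ n₂ : ℤ) (h₁ : n₀ + 1 = n₁) (h₂ : n₁ + 1 = n₂) {i j : EInt}
    (hij : i ≤ j) {M : Type u} [AddCommGroup M] [Module R M]
    (e : (X.H n₁).obj (mk₁ (homOfLE (bot_le : (⊥ : EInt) ≤ ⊤))) ≃ₗ[R] M)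
    (N N' : Submodule R M) (hN : N = LinearMap.range (e.toLinearMap ∘ₗ (X.toAbutment n₁ i).hom))
    (hN' : N' = LinearMap.range (e.toLinearMap ∘ₗ (X.toAbutment n₁ j).hom)) :
    Nonempty (X.E (homOfLE (bot_le : ⊥ ≤ i)) (homOfLE hij) (homOfLE (le_top : j ≤ ⊤))
      n₀ n₁ n₂ h₁ h₂ ≃ₗ[R] (N' ⧸ N.submoduleOf N')) := by
  subst hN hN'
  let π := (X.H n₁).map (twoδ₁Toδ₀ (homOfLE (bot_le : (⊥ : EInt) ≤ i)) (homOfLE hij) _ rfl)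
  let w := (X.H n₁).map (twoδ₂Toδ₁ (homOfLE (bot_le : (⊥ : EInt) ≤ i)) (homOfLE hij) _ rfl)
  have ex₂ := (ShortComplex.moduleCat_exact_iff _).1
    (X.exact₂ (homOfLE (bot_le : (⊥ : EInt) ≤ i)) (homOfLE hij) _ rfl n₁)
  have z₂ := X.zero₂ (homOfLE (bot_le : (⊥ : EInt) ≤ i)) (homOfLE hij) _ rfl n₁
  have hker : (LinearMap.ker π.hom).map (e.toLinearMap ∘ₗ (X.toAbutment n₁ j).hom) =
      LinearMap.range (e.toLinearMap ∘ₗ (X.toAbutment n₁ i).hom) := by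
    have hw : LinearMap.ker π.hom = LinearMap.range w.hom := by
      ext x
      constructor
      · intro hx
        exact ex₂ x hx
      · rintro ⟨y, rfl⟩
        exact congrArg (fun k => ModuleCat.Hom.hom k y) z₂
    rw [hw, ← X.map_comp_toAbutment n₁ hij, ModuleCat.hom_comp, ← LinearMap.comp_assoc]
    exact (LinearMap.range_comp w.hom _).symm
  rw [← hker]
  refine ShortComplex.homology_equiv_quotient
    (X.shortComplex (homOfLE (bot_le : (⊥ : EInt) ≤ i)) (homOfLE hij) (homOfLE le_top)
      n₀ n₁ n₂ h₁ h₂) π.hom (e.toLinearMap ∘ₗ (X.toAbutment n₁ j).hom) (fun x => ?_)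
      (fun x => ?_)
  · constructor
    · intro hx
      exact (ShortComplex.moduleCat_exact_iff _).1
        (X.exact₃ (homOfLE (bot_le : (⊥ : EInt) ≤ i)) (homOfLE hij) _ rfl n₁ n₂ h₂) x hx
    · rintro ⟨y, rfl⟩
      exact congrArg (fun k => ModuleCat.Hom.hom k y)
        (X.zero₃ (homOfLE (bot_le : (⊥ : EInt) ≤ i)) (homOfLE hij) _ rfl n₁ n₂ h₂)
  -- The connecting map of i ≤ j ≤ ∞ is that of -∞ ≤ j ≤ ∞ followed by π, and the image of the
  -- latter connecting map is the kernel of `toAbutment`.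
  · have hδ := X.δ_naturality (homOfLE (bot_le : (⊥ : EInt) ≤ j)) (homOfLE (le_top : j ≤ ⊤))
      (homOfLE hij) (homOfLE (le_top : j ≤ ⊤))
      (twoδ₁Toδ₀ (homOfLE (bot_le : (⊥ : EInt) ≤ i)) (homOfLE hij) _ rfl) (𝟙 _) n₀ n₁ rfl h₁
    rw [Functor.map_id, Category.id_comp] at hδ
    constructor
    · rintro ⟨y, rfl⟩
      refine ⟨X.δ (homOfLE (bot_le : (⊥ : EInt) ≤ j)) (homOfLE (le_top : j ≤ ⊤)) n₀ n₁ h₁ y,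
        ?_, congrArg (fun k => ModuleCat.Hom.hom k y) hδ.symm⟩
      have := congrArg (fun k => ModuleCat.Hom.hom k y)
        (X.zero₁ (homOfLE (bot_le : (⊥ : EInt) ≤ j)) (homOfLE (le_top : j ≤ ⊤)) _ rfl n₀ n₁ h₁)
      exact (congrArg e this).trans (map_zero e)
    · rintro ⟨a, ha, rfl⟩
      have ha' : X.toAbutment n₁ j a = 0 := e.injective (ha.trans (map_zero e).symm)
      obtain ⟨y, rfl⟩ := (ShortComplex.moduleCat_exact_iff _).1
        (X.exact₁ (homOfLE (bot_le : (⊥ : EInt) ≤ j)) (homOfLE (le_top : j ≤ ⊤)) _ rfl n₀ n₁ h₁)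
          a ha'
      exact ⟨y, congrArg (fun k => ModuleCat.Hom.hom k y) hδ⟩

/-- The spectral sequence of a third quadrant spectral object converges to the objects
`H^{-n}(-∞ ≤ ∞)`. -/
lemma convergesTo [X.IsThirdQuadrant] (H : ℕ → ModuleCat.{u} R)
    (e : ∀ n : ℕ, (X.H (-n)).obj (mk₁ (homOfLE (bot_le : (⊥ : EInt) ≤ ⊤))) ≃ₗ[R] H n) :
    HomologicalSpectralSequence.ConvergesTo (X.spectralSequence coreE₂HomologicalNat) H := by
  -- With q = n - p the index p - n + 1 is -q + 1, the upper end of the step -q ≤ -q + 1 which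
  -- carries E_{p,q}.
  refine ⟨fun n p => LinearMap.range ((e n).toLinearMap ∘ₗ
    (X.toAbutment (-n) ((p - n + 1 : ℤ) : EInt)).hom), fun n p p' h => ?_, fun n => ?_,
    fun n => ?_, fun p q => ?_⟩
  · have hle : ((p - n + 1 : ℤ) : EInt) ≤ ((p' - n + 1 : ℤ) : EInt) := by
      simp only [WithBotTop.coe_le_coe]; lia
    dsimp only
    rw [← X.map_comp_toAbutment _ hle, ModuleCat.hom_comp, ← LinearMap.comp_assoc]
    exact LinearMap.range_comp_le_range _ _
  -- For p = -1 the index is -n, the largest at which the third quadrant condition gives vanishing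
  -- in degree -n. For p = n it is 1, just beyond the last index 0.
  · rw [LinearMap.range_eq_bot]
    have hz := X.isZero₂_of_isThirdQuadrant ⊥ (((-1 : ℤ) - n + 1 : ℤ) : EInt) bot_le (-n)
      (by simp only [WithBotTop.coe_le_coe]; lia)
    rw [hz.eq_of_src (X.toAbutment (-n) (((-1 : ℤ) - n + 1 : ℤ) : EInt)) 0]
    simp
  · rw [LinearMap.range_eq_top, LinearMap.coe_comp]
    refine (e n).surjective.comp ?_
    have hz := X.isZero₁_of_isThirdQuadrant (((n : ℤ) - n + 1 : ℤ) : EInt) ⊤ le_top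
      (by simp only [WithBotTop.coe_lt_coe]; lia) (-n)
    have ex := X.exact₂ (homOfLE (bot_le : (⊥ : EInt) ≤ (((n : ℤ) - n + 1 : ℤ) : EInt)))
      (homOfLE le_top) _ rfl (-n)
    exact (ModuleCat.epi_iff_surjective _).1 (ex.epi_f (hz.eq_of_tgt _ _))
  -- From here on both differentials leave the quadrant, and the outer indices -q - k + 2 and -q + k
  -- - 1 are far enough out to be replaced by -∞ and ∞.
  · refine ⟨p + q + 3, fun k hk hk' => ⟨fun a => ?_, fun a => ?_, ?_⟩⟩
    · apply HomologicalComplex.shape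
      rw [ComplexShape.spectralSequenceNat_rel_iff]
      rintro ⟨-, h⟩
      dsimp only at h
      lia
    · apply HomologicalComplex.shape
      rw [ComplexShape.spectralSequenceNat_rel_iff]
      rintro ⟨h, -⟩
      dsimp only at h
      lia
    · have hi : (((p : ℤ) - 1 - (p + q : ℕ) + 1 : ℤ) : EInt) = ((-q : ℤ) : EInt) := by
        congr 1; push_cast; ring
      have hj : (((p : ℤ) - (p + q : ℕ) + 1 : ℤ) : EInt) = ((-q + 1 : ℤ) : EInt) := by
        congr 1; push_cast; ring
      have hn : (-((p + q : ℕ) : ℤ)) = -p - q := by push_cast; ring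
      have h₀₁ : ((-q - k + 2 : ℤ) : EInt) ≤ ((-q : ℤ) : EInt) := by
        simp only [WithBotTop.coe_le_coe]; lia
      have h₁₂ : ((-q : ℤ) : EInt) ≤ ((-q + 1 : ℤ) : EInt) := by
        simp only [WithBotTop.coe_le_coe]; lia
      have h₂₃ : ((-q + 1 : ℤ) : EInt) ≤ ((-q + k - 1 : ℤ) : EInt) := by
        simp only [WithBotTop.coe_le_coe]; lia
      let n : ℤ := -((p + q : ℕ) : ℤ)
      have e₁ := X.spectralSequencePageXIso coreE₂HomologicalNat k hk (p, q)
        ((-q - k + 2 : ℤ) : EInt) ((-q : ℤ) : EInt) ((-q + 1 : ℤ) : EInt)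
        ((-q + k - 1 : ℤ) : EInt) rfl rfl rfl rfl (n - 1) n (n + 1) hn
      -- `e₂` moves the lowest index to -∞ and `e₃` the highest to ∞. What results is the term
      -- treated in `limit_equiv`.
      have e₂ := X.isoMapFourδ₁Toδ₀' ⊥ ((-q - k + 2 : ℤ) : EInt) ((-q : ℤ) : EInt)
        ((-q + 1 : ℤ) : EInt) ((-q + k - 1 : ℤ) : EInt) bot_le h₀₁ h₁₂ h₂₃ (n - 1) n (n + 1)
        (X.isZero₂_of_isThirdQuadrant _ _ _ _ (by
          simp only [WithBotTop.coe_le_coe, n]; lia)) (by lia) (by lia)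
      have e₃ := X.isoMapFourδ₄Toδ₃' ⊥ ((-q : ℤ) : EInt)
        ((-q + 1 : ℤ) : EInt) ((-q + k - 1 : ℤ) : EInt) ⊤ bot_le h₁₂ h₂₃ le_top (n - 1) n (n + 1)
        (X.isZero₁_of_isThirdQuadrant _ _ _ (by
          simp only [WithBotTop.coe_lt_coe]; lia) _) (by lia) (by lia)
      obtain ⟨e₄⟩ := X.limit_equiv (n - 1) n (n + 1) (by lia) (by lia) h₁₂ (e (p + q)) _ _
        (congrArg (fun i => LinearMap.range ((e (p + q)).toLinearMap ∘ₗ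
          (X.toAbutment (-(p + q : ℕ)) i).hom)) hi)
        (congrArg (fun i => LinearMap.range ((e (p + q)).toLinearMap ∘ₗ
          (X.toAbutment (-(p + q : ℕ)) i).hom)) hj)
      exact ⟨(e₁ ≪≫ e₂.symm ≪≫ e₃).toLinearEquiv ≪≫ₗ e₄⟩

end CategoryTheory.Abelian.SpectralObject

/-! ### The spectral object of a filtered complex -/

/-- A filtration of a cochain complex of modules by subcomplexes. -/
structure CochainComplex.Filtration {R : Type r} [Ring R]
    (C : CochainComplex (ModuleCat.{u} R) ℤ) (ι : Type) [Preorder ι] where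
  /-- the submodules of the filtration -/
  sub : ι → ∀ n, Submodule R (C.X n)
  mono : ∀ {i j}, i ≤ j → ∀ n, sub i n ≤ sub j n
  d_mem : ∀ {i n} {x : C.X n}, x ∈ sub i n → ∀ m, C.d n m x ∈ sub i m

namespace CochainComplex.Filtration

variable {R : Type r} [Ring R] {C : CochainComplex (ModuleCat.{u} R) ℤ} {ι : Type} [Preorder ι]
  (F : C.Filtration ι)

lemma d_d_apply {m n k : ℤ} (x : C.X m) : C.d n k (C.d m n x) = 0 :=
  congrArg (fun f => ModuleCat.Hom.hom f x) (C.d_comp_d m n k)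

/-- The chains in the `j`-th step of the filtration with boundary in the `i`-th step. -/
def cycles (i j : ι) (n : ℤ) : Submodule R (C.X n) where
  carrier := {x | x ∈ F.sub j n ∧ ∀ m, C.d n m x ∈ F.sub i m}
  add_mem' := fun hx hy => ⟨add_mem hx.1 hy.1, fun m => by
    rw [map_add]; exact add_mem (hx.2 m) (hy.2 m)⟩
  zero_mem' := ⟨zero_mem _, fun m => by rw [map_zero]; exact zero_mem _⟩
  smul_mem' := fun c x hx => ⟨Submodule.smul_mem _ c hx.1, fun m => by
    rw [map_smul]; exact Submodule.smul_mem _ c (hx.2 m)⟩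

/-- The sum of the `i`-th step of the filtration and of the boundaries of the `j`-th step. -/
def boundaries (i j : ι) (n : ℤ) : Submodule R (C.X n) :=
  F.sub i n ⊔ (F.sub j (n - 1)).map (C.d (n - 1) n).hom

lemma mem_boundaries {i j : ι} {m n : ℤ} (h : m + 1 = n) {x : C.X n} :
    x ∈ F.boundaries i j n ↔ ∃ y ∈ F.sub j m, x - C.d m n y ∈ F.sub i n := by
  obtain rfl : m = n - 1 := by lia
  rw [boundaries, Submodule.mem_sup]
  constructor
  · rintro ⟨a, ha, _, ⟨y, hy, rfl⟩, rfl⟩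
    refine ⟨y, hy, ?_⟩
    have : a + (C.d (n - 1) n).hom y - C.d (n - 1) n y = a := add_sub_cancel_right _ _
    rwa [this]
  · rintro ⟨y, hy, hxy⟩
    exact ⟨_, hxy, _, ⟨y, hy, rfl⟩, sub_add_cancel _ _⟩

lemma cycles_mono {i j i' j' : ι} (hi : i ≤ i') (hj : j ≤ j') (n : ℤ) :
    F.cycles i j n ≤ F.cycles i' j' n :=
  fun _ hx => ⟨F.mono hj n hx.1, fun m => F.mono hi m (hx.2 m)⟩

lemma boundaries_mono {i j i' j' : ι} (hi : i ≤ i') (hj : j ≤ j') (n : ℤ) :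
    F.boundaries i j n ≤ F.boundaries i' j' n :=
  sup_le_sup (F.mono hi n) (Submodule.map_mono (F.mono hj _))

/-- The cohomology of the quotient of the `j`-th step of the filtration by the `i`-th step. -/
abbrev quot (i j : ι) (n : ℤ) : Type u :=
  F.cycles i j n ⧸ (F.boundaries i j n).submoduleOf (F.cycles i j n)

/-- The class of a relative cycle. -/
def cls {i j : ι} {n : ℤ} (x : C.X n) (hx : x ∈ F.cycles i j n) : F.quot i j n :=
  Submodule.Quotient.mk ⟨x, hx⟩

lemma cls_surjective {i j : ι} {n : ℤ} (c : F.quot i j n) : ∃ x hx, F.cls x hx = c := by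
  obtain ⟨⟨x, hx⟩, rfl⟩ := Submodule.Quotient.mk_surjective _ c
  exact ⟨x, hx, rfl⟩

lemma cls_eq_zero_iff {i j : ι} {m n : ℤ} (h : m + 1 = n) {x : C.X n} (hx : x ∈ F.cycles i j n) :
    F.cls x hx = 0 ↔ ∃ y ∈ F.sub j m, x - C.d m n y ∈ F.sub i n :=
  (Submodule.Quotient.mk_eq_zero _).trans (F.mem_boundaries h)

/-- The map of cohomology modules induced by inclusions. -/
def quotMap {i j i' j' : ι} (hi : i ≤ i') (hj : j ≤ j') (n : ℤ) :
    F.quot i j n →ₗ[R] F.quot i' j' n :=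
  Submodule.mapQ _ _ (Submodule.inclusion (F.cycles_mono hi hj n))
    fun _ hx => F.boundaries_mono hi hj n hx

/-- The connecting homomorphism. -/
def connecting (i j k : ι) (n m : ℤ) (h : n + 1 = m) : F.quot j k n →ₗ[R] F.quot i j m :=
  Submodule.mapQ _ _ (((C.d n m).hom.domRestrict _).codRestrict _ fun x =>
      ⟨x.2.2 m, fun l => by
        change C.d m l (C.d n m x.1) ∈ _
        rw [d_d_apply]
        exact zero_mem _⟩) fun x hx => by
    obtain ⟨y, -, hy⟩ := (F.mem_boundaries (sub_add_cancel n 1)).1 hx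
    refine (F.mem_boundaries h).2 ⟨_, hy, ?_⟩
    have : C.d n m x.1 - C.d n m (x.1 - C.d (n - 1) n y) = 0 := by
      rw [map_sub, d_d_apply, sub_zero, sub_self]
    exact (this.symm ▸ zero_mem _ : C.d n m x.1 - C.d n m (x.1 - C.d (n - 1) n y) ∈ F.sub i m)

lemma d_mem_cycles {i j k : ι} {n m : ℤ} {x : C.X n} (hx : x ∈ F.cycles j k n) :
    C.d n m x ∈ F.cycles i j m :=
  ⟨hx.2 m, fun l => by rw [d_d_apply]; exact zero_mem _⟩

lemma connecting_comp_quotMap {i j k i' j' k' : ι} (hi : i ≤ i') (hj : j ≤ j') (hk : k ≤ k')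
    (n m : ℤ) (h : n + 1 = m) :
    F.connecting i' j' k' n m h ∘ₗ F.quotMap hj hk n =
      F.quotMap hi hj m ∘ₗ F.connecting i j k n m h := by
  refine LinearMap.ext fun c => ?_
  obtain ⟨x, hx, rfl⟩ := F.cls_surjective c
  rfl

/-- If x - dy lies in step i with y in step k, then dy lies in step j along with x, so y is a
relative cycle whose connecting image is the class of x. -/
lemma exact_connecting_quotMap {i j k : ι} (hij : i ≤ j) (hjk : j ≤ k) (n m : ℤ)
    (h : n + 1 = m) :
    Function.Exact (F.connecting i j k n m h) (F.quotMap (le_refl i) hjk m) := by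
  refine LinearMap.exact_of_comp_of_mem_range (LinearMap.ext fun c => ?_) fun c hc => ?_
  · obtain ⟨x, hx, rfl⟩ := F.cls_surjective c
    exact (F.cls_eq_zero_iff h (x := C.d n m x)
      (F.cycles_mono (le_refl i) hjk m (F.d_mem_cycles hx))).2
        ⟨x, hx.1, by rw [sub_self]; exact zero_mem _⟩
  · obtain ⟨x, hx, rfl⟩ := F.cls_surjective c
    obtain ⟨y, hy, hxy⟩ := (F.cls_eq_zero_iff h (F.cycles_mono (le_refl i) hjk m hx)).1 hc
    -- The case split is needed because relative cycles are tested on all differentials out of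
    -- degree n; those to a degree other than n + 1 are zero.
    have hd : ∀ l, C.d n l y ∈ F.sub j l := fun l => by
      by_cases hl : n + 1 = l
      · obtain rfl : l = m := by lia
        rw [← sub_sub_cancel x (C.d n l y)]
        exact sub_mem hx.1 (F.mono hij l hxy)
      · rw [C.shape n l hl]
        exact zero_mem _
    refine ⟨F.cls y ⟨hy, hd⟩, ?_⟩
    refine sub_eq_zero.1 ?_
    refine (F.cls_eq_zero_iff (m := n) h (sub_mem (F.d_mem_cycles ⟨hy, hd⟩) hx)).2
      ⟨0, zero_mem _, ?_⟩
    rw [map_zero, sub_zero, ← neg_sub]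
    exact neg_mem hxy

/-- A class that dies modulo step j is represented by x - dy in step j, and its boundary is that of
x. -/
lemma exact_quotMap_quotMap {i j k : ι} (hij : i ≤ j) (hjk : j ≤ k) (n : ℤ) :
    Function.Exact (F.quotMap (le_refl i) hjk n) (F.quotMap hij (le_refl k) n) := by
  refine LinearMap.exact_of_comp_of_mem_range (LinearMap.ext fun c => ?_) fun c hc => ?_
  · obtain ⟨x, hx, rfl⟩ := F.cls_surjective c
    exact (F.cls_eq_zero_iff (sub_add_cancel n 1) _).2
      ⟨0, zero_mem _, by rw [map_zero, sub_zero]; exact hx.1⟩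
  · obtain ⟨x, hx, rfl⟩ := F.cls_surjective c
    obtain ⟨y, hy, hxy⟩ := (F.cls_eq_zero_iff (sub_add_cancel n 1)
      (F.cycles_mono hij (le_refl k) n hx)).1 hc
    have hd : ∀ l, C.d n l (x - C.d (n - 1) n y) ∈ F.sub i l := fun l => by
      rw [map_sub, d_d_apply, sub_zero]
      exact hx.2 l
    refine ⟨F.cls (x - C.d (n - 1) n y) ⟨hxy, hd⟩, ?_⟩
    refine sub_eq_zero.1 ?_
    refine (F.cls_eq_zero_iff (sub_add_cancel n 1) (sub_mem ⟨F.mono hjk n hxy, hd⟩ hx)).2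
      ⟨-y, neg_mem hy, ?_⟩
    rw [map_neg, sub_neg_eq_add, sub_sub_cancel_left, neg_add_cancel]
    exact zero_mem _

/-- If dx and dy agree modulo step i for some y in step j, then x - y is a cycle modulo step i and
has the class of x modulo step j. -/
lemma exact_quotMap_connecting {i j k : ι} (hij : i ≤ j) (hjk : j ≤ k) (n m : ℤ)
    (h : n + 1 = m) :
    Function.Exact (F.quotMap hij (le_refl k) n) (F.connecting i j k n m h) := by
  refine LinearMap.exact_of_comp_of_mem_range (LinearMap.ext fun c => ?_) fun c hc => ?_
  · obtain ⟨x, hx, rfl⟩ := F.cls_surjective c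
    refine (F.cls_eq_zero_iff h
      (F.d_mem_cycles (F.cycles_mono hij (le_refl k) n hx))).2 ⟨0, zero_mem _, ?_⟩
    rw [map_zero, sub_zero]
    exact hx.2 m
  · obtain ⟨x, hx, rfl⟩ := F.cls_surjective c
    obtain ⟨y, hy, hxy⟩ := (F.cls_eq_zero_iff h (F.d_mem_cycles hx)).1 hc
    have hd : x - y ∈ F.cycles i k n := by
      refine ⟨sub_mem hx.1 (F.mono hjk n hy), fun l => ?_⟩
      by_cases hl : n + 1 = l
      · obtain rfl : l = m := by lia
        rw [map_sub]
        exact hxy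
      · rw [C.shape n l hl]
        exact zero_mem _
    refine ⟨F.cls (x - y) hd, ?_⟩
    refine sub_eq_zero.1 ?_
    refine (F.cls_eq_zero_iff (sub_add_cancel n 1) (sub_mem
      (F.cycles_mono hij le_rfl n hd) hx)).2 ⟨0, zero_mem _, ?_⟩
    rw [map_zero, sub_zero, sub_sub_cancel_left]
    exact neg_mem hy

open ComposableArrows Abelian

lemma mk₂_exact {X Y Z : ModuleCat.{u} R} {f : X ⟶ Y} {g : Y ⟶ Z}
    (h : Function.Exact f.hom g.hom) : (ComposableArrows.mk₂ f g).Exact :=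
  ShortComplex.Exact.exact_toComposableArrows
    (S := ShortComplex.mk f g (ModuleCat.hom_ext (LinearMap.ext h.apply_apply_eq_zero)))
    ((ShortComplex.moduleCat_exact_iff _).2 fun x hx => (h x).1 hx)

/-- The spectral object of a filtered complex. -/
def spectralObject : SpectralObject (ModuleCat.{u} R) ι where
  H n :=
    { obj := fun D => ModuleCat.of R (F.quot (D.obj 0) (D.obj 1) n)
      map := fun φ => ModuleCat.ofHom (F.quotMap (leOfHom (φ.app 0)) (leOfHom (φ.app 1)) n)
      map_id := fun D => by
        refine ModuleCat.hom_ext (LinearMap.ext fun c => ?_)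
        obtain ⟨x, hx, rfl⟩ := F.cls_surjective c
        rfl
      map_comp := fun φ ψ => by
        refine ModuleCat.hom_ext (LinearMap.ext fun c => ?_)
        obtain ⟨x, hx, rfl⟩ := F.cls_surjective c
        rfl }
  δ' n m h :=
    { app := fun D => ModuleCat.ofHom (F.connecting (D.obj 0) (D.obj 1) (D.obj 2) n m h)
      naturality := fun D D' φ => ModuleCat.hom_ext (F.connecting_comp_quotMap
        (leOfHom (φ.app 0)) (leOfHom (φ.app 1)) (leOfHom (φ.app 2)) n m h) }
  exact₁' n m h D := mk₂_exact (F.exact_connecting_quotMap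
    (leOfHom (D.map' 0 1)) (leOfHom (D.map' 1 2)) n m h)
  exact₂' n D := mk₂_exact (F.exact_quotMap_quotMap
    (leOfHom (D.map' 0 1)) (leOfHom (D.map' 1 2)) n)
  exact₃' n m h D := mk₂_exact (F.exact_quotMap_connecting
    (leOfHom (D.map' 0 1)) (leOfHom (D.map' 1 2)) n m h)

lemma isZero_quot {i j : ι} {n : ℤ} (h : F.sub j n ≤ F.sub i n) :
    Limits.IsZero (ModuleCat.of R (F.quot i j n)) := by
  rw [ModuleCat.isZero_of_iff_subsingleton]
  refine ⟨fun a b => ?_⟩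
  have : ∀ c : F.quot i j n, c = 0 := fun c => by
    obtain ⟨x, hx, rfl⟩ := F.cls_surjective c
    refine (F.cls_eq_zero_iff (sub_add_cancel n 1) hx).2 ⟨0, zero_mem _, ?_⟩
    rw [map_zero, sub_zero]
    exact h hx.1
  rw [this a, this b]

/-- For an exhaustive separated filtration, the module `H^n(-∞ ≤ ∞)` is the cohomology of the
complex. -/
lemma quot_equiv_homology {i j : ι} (hi : ∀ n, F.sub i n = ⊥) (hj : ∀ n, F.sub j n = ⊤) (n : ℤ) :
    Nonempty (F.quot i j n ≃ₗ[R] C.homology n) := by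
  have e := (C.homologyIsoSc' (n - 1) n (n + 1) (by simp) (by simp)).toLinearEquiv
  let S := C.sc' (n - 1) n (n + 1)
  have h0 : ∀ a : F.cycles i j n, S.g ((F.cycles i j n).subtype a) = 0 := fun a => by
    have := a.2.2 (n + 1)
    rwa [hi, Submodule.mem_bot] at this
  refine ⟨LinearMap.equivOfSurjectiveOfKerEq (Submodule.mkQ _)
    (S.homologyClass (F.cycles i j n).subtype h0)
    (Submodule.mkQ_surjective _) (S.homologyClass_surjective _ h0 fun x hx => ?_) (fun a => ?_) ≪≫ₗ
      e.symm⟩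
  · refine ⟨⟨x, by rw [hj]; trivial, fun m => ?_⟩, 0, by rw [map_zero, add_zero]; rfl⟩
    rw [hi, Submodule.mem_bot]
    by_cases hm : n + 1 = m
    · subst hm
      exact hx
    · rw [C.shape n m hm]
      rfl
  · refine Iff.trans ?_ (ShortComplex.homologyClass_eq_zero_iff _ _ h0 a).symm
    refine (F.cls_eq_zero_iff (sub_add_cancel n 1) a.2).trans ?_
    simp only [hi, hj, Submodule.mem_bot, Submodule.mem_top, true_and, sub_eq_zero]
    exact exists_congr fun y => eq_comm

end CochainComplex.Filtration

namespace HomologicalComplex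

variable {R : Type r} [Ring R] {ι : Type*} {c : ComplexShape ι}
  (C : HomologicalComplex (ModuleCat.{u} R) c)

/-- The homology class of a family of cycles depending linearly on a parameter. -/
def homologyClass {A : Type u} [AddCommGroup A] [Module R A] {j : ι} (φ : A →ₗ[R] C.X j)
    (h : ∀ a k, C.d j k (φ a) = 0) : A →ₗ[R] C.homology j :=
  (C.sc j).homologyClass φ fun a => h a _

lemma homologyClass_eq_zero_iff {A : Type u} [AddCommGroup A] [Module R A] {i j : ι}
    (hij : c.prev j = i) (φ : A →ₗ[R] C.X j) (h : ∀ a k, C.d j k (φ a) = 0) (a : A) :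
    C.homologyClass φ h a = 0 ↔ ∃ x, C.d i j x = φ a := by
  subst hij
  exact (C.sc j).homologyClass_eq_zero_iff φ _ a

lemma homologyClass_surjective {A : Type u} [AddCommGroup A] [Module R A] {j : ι}
    (φ : A →ₗ[R] C.X j) (h : ∀ a k, C.d j k (φ a) = 0)
    (h' : ∀ x, (∀ k, C.d j k x = 0) → ∃ a, φ a = x) :
    Function.Surjective (C.homologyClass φ h) := by
  refine (C.sc j).homologyClass_surjective φ _ fun x hx => ?_
  have hx' : ∀ k, C.d j k x = 0 := fun k => by
    by_cases hk : c.Rel j k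
    · obtain rfl := c.next_eq' hk
      exact hx
    · rw [C.shape j k hk]
      rfl
  obtain ⟨a, rfl⟩ := h' x hx'
  exact ⟨a, 0, by rw [map_zero, add_zero]; rfl⟩

end HomologicalComplex

/-! ### The total complex of a first quadrant double complex -/

/-- First quadrant double complexes of modules, as complexes of complexes. -/
abbrev DoubleComplex (R : Type r) [Ring R] :=
  ChainComplex (ChainComplex (ModuleCat.{u} R) ℕ) ℕ

namespace DoubleComplex

variable {R : Type r} [Ring R] (K : DoubleComplex.{r, u} R)

/-- The vertical differential. -/
def vd (p q : ℕ) : (K.X (q + 1)).X p →ₗ[R] (K.X q).X p := ((K.d (q + 1) q).f p).hom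

/-- The horizontal differential. -/
def hd (p q : ℕ) : (K.X q).X (p + 1) →ₗ[R] (K.X q).X p := ((K.X q).d (p + 1) p).hom

@[simp]
lemma vd_vd (p q : ℕ) (x : (K.X (q + 2)).X p) : K.vd p q (K.vd p (q + 1) x) = 0 :=
  congrArg (fun f => ModuleCat.Hom.hom (HomologicalComplex.Hom.f f p) x)
    (K.d_comp_d (q + 2) (q + 1) q)

@[simp]
lemma hd_hd (p q : ℕ) (x : (K.X q).X (p + 2)) : K.hd p q (K.hd (p + 1) q x) = 0 :=
  congrArg (fun f => ModuleCat.Hom.hom f x) ((K.X q).d_comp_d (p + 2) (p + 1) p)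

lemma vd_hd (p q : ℕ) (x : (K.X (q + 1)).X (p + 1)) :
    K.vd p q (K.hd p (q + 1) x) = K.hd p q (K.vd (p + 1) q x) :=
  (congrArg (fun f => ModuleCat.Hom.hom f x) ((K.d (q + 1) q).comm (p + 1) p)).symm

/-- The chains of total degree `-n`. -/
abbrev Tot (n : ℤ) : Type u :=
  ∀ a : {a : ℕ × ℕ // (a.1 + a.2 : ℤ) = -n}, (K.X a.1.2).X a.1.1

variable {K} in
lemma Tot.ext {n : ℤ} {x y : K.Tot n} (h : ∀ p q h, x ⟨(p, q), h⟩ = y ⟨(p, q), h⟩) : x = y :=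
  funext fun a => h a.1.1 a.1.2 a.2

/-- The total differential. -/
def totD (n m : ℤ) (h : n + 1 = m) : K.Tot n →ₗ[R] K.Tot m :=
  LinearMap.pi fun a =>
    K.vd a.1.1 a.1.2 ∘ₗ LinearMap.proj
      (⟨(a.1.1, a.1.2 + 1), by have := a.2; push_cast; lia⟩ :
        {a : ℕ × ℕ // (a.1 + a.2 : ℤ) = -n}) +
    -- The vertical and horizontal differentials commute; the sign makes their contributions to the
    -- square cancel.
    ((-1 : ℤ) ^ a.1.2) • (K.hd a.1.1 a.1.2 ∘ₗ LinearMap.proj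
      (⟨(a.1.1 + 1, a.1.2), by have := a.2; push_cast; lia⟩ :
        {a : ℕ × ℕ // (a.1 + a.2 : ℤ) = -n}))

lemma totD_apply (n m : ℤ) (h : n + 1 = m) (x : K.Tot n) (p q : ℕ) (hpq : (p + q : ℤ) = -m) :
    K.totD n m h x ⟨(p, q), hpq⟩ =
      K.vd p q (x ⟨(p, q + 1), by push_cast; lia⟩) +
        ((-1 : ℤ) ^ q) • K.hd p q (x ⟨(p + 1, q), by push_cast; lia⟩) := rfl

lemma totD_totD (n m k : ℤ) (h : n + 1 = m) (h' : m + 1 = k) (x : K.Tot n) :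
    K.totD m k h' (K.totD n m h x) = 0 := by
  refine Tot.ext fun p q hpq => ?_
  simp only [totD_apply, map_add, vd_vd, zero_add, map_zsmul, hd_hd, smul_zero, add_zero, vd_hd]
  rw [pow_succ, mul_neg_one, neg_smul, neg_add_cancel]
  rfl

/-- The total complex, with cohomological indexing. -/
def total : CochainComplex (ModuleCat.{u} R) ℤ where
  X n := ModuleCat.of R (K.Tot n)
  d n m := if h : n + 1 = m then ModuleCat.ofHom (K.totD n m h) else 0
  shape n m h := dif_neg h
  d_comp_d' n m k h h' := by
    obtain rfl : n + 1 = m := h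
    obtain rfl : n + 1 + 1 = k := h'
    rw [dif_pos rfl, dif_pos rfl]
    refine ModuleCat.hom_ext (LinearMap.ext fun x => K.totD_totD n _ _ rfl rfl x)

lemma total_d (n m : ℤ) (h : n + 1 = m) : K.total.d n m = ModuleCat.ofHom (K.totD n m h) :=
  dif_pos h

lemma total_d_apply (n m : ℤ) (h : n + 1 = m) (x : K.Tot n) :
    K.total.d n m x = K.totD n m h x := by
  rw [K.total_d n m h]
  rfl

/-- The chain of the total complex with a single non-zero component. -/
def single {n : ℤ} (p q : ℕ) (h : (p + q : ℤ) = -n) : (K.X q).X p →ₗ[R] K.Tot n :=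
  LinearMap.single R (fun a : {a : ℕ × ℕ // (a.1 + a.2 : ℤ) = -n} => (K.X a.1.2).X a.1.1)
    ⟨(p, q), h⟩

lemma single_same {n : ℤ} (p q : ℕ) (h h' : (p + q : ℤ) = -n) (x : (K.X q).X p) :
    K.single p q h x ⟨(p, q), h'⟩ = x :=
  Pi.single_eq_same (M := fun a : {a : ℕ × ℕ // (a.1 + a.2 : ℤ) = -n} => (K.X a.1.2).X a.1.1)
    ⟨(p, q), h⟩ x

lemma single_of_ne {n : ℤ} (p q : ℕ) (h : (p + q : ℤ) = -n) (x : (K.X q).X p) {p' q' : ℕ}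
    (h' : (p' + q' : ℤ) = -n) (hq : q' ≠ q) : K.single p q h x ⟨(p', q'), h'⟩ = 0 :=
  Pi.single_eq_of_ne (M := fun a : {a : ℕ × ℕ // (a.1 + a.2 : ℤ) = -n} => (K.X a.1.2).X a.1.1)
    (i := ⟨(p, q), h⟩) (i' := ⟨(p', q'), h'⟩) (fun e => hq (congrArg (fun a => a.1.2) e)) x

/-- The chains of the total complex which lie in the canonical truncation of the columns. -/
def truncation (b : EInt) (n : ℤ) : Submodule R (K.Tot n) where
  -- The rows q ≤ -b vanish and row 1 - b consists of vertical cycles. Thus the step from -q to -q +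
  -- 1 captures the q-th homology of the columns.
  carrier := {x | (∀ (p q : ℕ) h, b ≤ ((-(q : ℤ) : ℤ) : EInt) → x ⟨(p, q), h⟩ = 0) ∧
    ∀ (p q : ℕ) h, b ≤ ((-(q : ℤ) : ℤ) : EInt) → K.vd p q (x ⟨(p, q + 1), h⟩) = 0}
  zero_mem' := ⟨fun _ _ _ _ => rfl, fun _ _ _ _ => map_zero _⟩
  add_mem' := fun {x y} hx hy => ⟨fun p q h hb => by
      rw [Pi.add_apply, hx.1 p q h hb, hy.1 p q h hb, add_zero],
    fun p q h hb => by
      rw [Pi.add_apply, map_add, hx.2 p q h hb, hy.2 p q h hb, add_zero]⟩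
  smul_mem' := fun c x hx => ⟨fun p q h hb => by
      rw [Pi.smul_apply, hx.1 p q h hb, smul_zero],
    fun p q h hb => by
      rw [Pi.smul_apply, map_smul, hx.2 p q h hb, smul_zero]⟩

lemma totD_mem_truncation {b : EInt} {n m : ℤ} (hm : n + 1 = m) {x : K.Tot n}
    (hx : x ∈ K.truncation b n) : K.totD n m hm x ∈ K.truncation b m := by
  refine ⟨fun p q h hb => ?_, fun p q h hb => ?_⟩
  · rw [totD_apply, hx.1 _ _ _ hb, hx.2 _ _ _ hb, map_zero, smul_zero, add_zero]
  · rw [totD_apply, map_add, vd_vd, map_zsmul, vd_hd, hx.2 _ _ _ hb, map_zero, smul_zero,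
      add_zero]

/-- The filtration of the total complex by the canonical truncations of the columns. -/
def filtration : K.total.Filtration EInt where
  sub b n := K.truncation b n
  mono := fun h _ _ hx => ⟨fun p q h' hb => hx.1 p q h' (h.trans hb),
    fun p q h' hb => hx.2 p q h' (h.trans hb)⟩
  d_mem := fun {b n x} hx m => by
    by_cases hm : n + 1 = m
    · exact (congrArg (· ∈ K.truncation b m) (K.total_d_apply n m hm x)).mpr
        (K.totD_mem_truncation hm hx)
    · rw [K.total.shape n m hm]
      exact zero_mem _

/-- In a row q where x vanishes, the total boundary of x is just the vertical boundary of its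
component in row q + 1. The second condition of `truncation` can thus be read off from the total
differential. -/
lemma mem_filtration_of_totD {b : EInt} {n m : ℤ} (hm : n + 1 = m) {x : K.Tot n}
    (hx : ∀ (p q : ℕ) h, b ≤ ((-(q : ℤ) : ℤ) : EInt) → x ⟨(p, q), h⟩ = 0)
    (hdx : ∀ (p q : ℕ) h, b ≤ ((-(q : ℤ) : ℤ) : EInt) → K.totD n m hm x ⟨(p, q), h⟩ = 0) :
    x ∈ K.filtration.sub b n := by
  refine ⟨hx, fun p q h hb => ?_⟩
  have h1 := hdx p q (by push_cast at h; lia) hb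
  rwa [totD_apply, hx (p + 1) q _ hb, map_zero, smul_zero, add_zero] at h1

lemma filtration_bot (n : ℤ) : K.filtration.sub ⊥ n = ⊥ := by
  rw [eq_bot_iff]
  intro x hx
  rw [Submodule.mem_bot]
  exact Tot.ext fun p q h => hx.1 p q h bot_le

lemma filtration_of_pos {b : EInt} (hb : ((0 : ℤ) : EInt) < b) (n : ℤ) :
    K.filtration.sub b n = ⊤ := by
  rw [eq_top_iff]
  intro x _
  have h : ∀ q : ℕ, ¬ b ≤ ((-(q : ℤ) : ℤ) : EInt) := fun q h => by
    have := hb.trans_le h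
    rw [WithBotTop.coe_lt_coe] at this
    lia
  exact ⟨fun p q _ hq => (h q hq).elim, fun p q _ hq => (h q hq).elim⟩

lemma filtration_of_le {b : EInt} {n : ℤ} (hb : b ≤ ((n : ℤ) : EInt)) :
    K.filtration.sub b n = ⊥ := by
  rw [eq_bot_iff]
  intro x hx
  rw [Submodule.mem_bot]
  refine Tot.ext fun p q h => hx.1 p q h (hb.trans ?_)
  rw [WithBotTop.coe_le_coe]
  lia

/-- The rows satisfy 0 ≤ q ≤ -n in degree n: the filtration is everything beyond index 0 and zero up
to index n. -/
instance : K.filtration.spectralObject.IsThirdQuadrant where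
  isZero₁ i j hij hi n := K.filtration.isZero_quot (by
    change K.filtration.sub j n ≤ K.filtration.sub i n
    rw [K.filtration_of_pos hi]
    exact le_top)
  isZero₂ i j hij n hj := K.filtration.isZero_quot (by
    change K.filtration.sub j n ≤ K.filtration.sub i n
    rw [K.filtration_of_le hj]
    exact bot_le)

variable {K} {p q : ℕ} {W Z : ChainComplex (ModuleCat.{u} R) ℕ}
  {i : Z ⟶ K.X q} {ρ : Z ⟶ W}

/-- Every vertical cycle whose horizontal boundary is a vertical boundary is a component of a
cycle relative to the filtration. -/
lemma exists_mem_cycles {v : (K.X q).X p} {n : ℤ} (hn : (p + q : ℤ) = -n)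
    (hv : ∀ q', (K.d q q').f p v = 0)
    (hv' : ∀ k (hk : p = k + 1), ∃ u, K.vd k q u = K.hd k q (hk ▸ v)) :
    ∃ x : K.Tot n, x ∈ K.filtration.cycles ((-(q : ℤ) : ℤ) : EInt) ((-(q : ℤ) + 1 : ℤ) : EInt) n ∧
      x ⟨(p, q), hn⟩ = v := by
  obtain ⟨x, hx, hx₀, hx₁⟩ : ∃ x : K.Tot n, x ⟨(p, q), hn⟩ = v ∧
      (∀ p' q' h, q' < q → x ⟨(p', q'), h⟩ = 0) ∧
      ∀ p' h h', K.vd p' q (x ⟨(p', q + 1), h⟩) + ((-1 : ℤ) ^ q) •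
        K.hd p' q (x ⟨(p' + 1, q), h'⟩) = 0 := by
    obtain _ | k := p
    · refine ⟨K.single 0 q hn v, K.single_same _ _ _ _ _, fun p' q' h hq =>
        K.single_of_ne _ _ _ _ _ hq.ne, fun p' h => ?_⟩
      push_cast at h hn
      lia
    · obtain ⟨u, hu⟩ := hv' k rfl
      -- The correction in row q + 1 cancels the horizontal boundary of v, which enters the total
      -- differential with sign (-1)^q.
      refine ⟨K.single (k + 1) q hn v -
        ((-1 : ℤ) ^ q) • K.single k (q + 1) (by push_cast at hn ⊢; lia) u, ?_, ?_, ?_⟩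
      · simp only [Pi.sub_apply, Pi.smul_apply]
        rw [single_same, single_of_ne _ _ _ _ _ _ (by lia), smul_zero, sub_zero]
      · intro p' q' h hq
        simp only [Pi.sub_apply, Pi.smul_apply]
        rw [single_of_ne _ _ _ _ _ _ (by lia), single_of_ne _ _ _ _ _ _ (by lia), smul_zero,
          sub_zero]
      · intro p' h h'
        obtain rfl : p' = k := by push_cast at h hn; lia
        simp only [Pi.sub_apply, Pi.smul_apply]
        rw [single_same, single_same, single_of_ne _ _ _ _ _ _ (by lia),
          single_of_ne _ _ _ _ _ _ (by lia), smul_zero, zero_sub, sub_zero, map_neg, map_zsmul,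
          hu, neg_add_cancel]
  refine ⟨x, ⟨⟨fun p' q' h hb => ?_, fun p' q' h hb => ?_⟩, fun m => ?_⟩, hx⟩
  · rw [WithBotTop.coe_le_coe] at hb
    exact hx₀ p' q' h (by lia)
  · rw [WithBotTop.coe_le_coe] at hb
    obtain hq | rfl := (show q' + 1 ≤ q by lia).lt_or_eq
    · rw [hx₀ _ _ _ hq, map_zero]
    · obtain rfl : p' = p := by lia
      rw [hx]
      exact hv q'
  · by_cases hm : n + 1 = m
    · rw [K.total_d_apply n m hm]
      -- The total boundary of x is itself a total cycle, so only its vanishing in the rows up to q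
      -- has to be checked.
      refine K.mem_filtration_of_totD rfl (fun p' q' h hb => ?_) fun p' q' h hb => ?_
      · rw [WithBotTop.coe_le_coe] at hb
        rw [totD_apply]
        obtain hq | rfl := (show q' ≤ q by lia).lt_or_eq
        · rw [hx₀ (p' + 1) q' _ hq, map_zero, smul_zero, add_zero]
          obtain hq' | rfl := (show q' + 1 ≤ q by lia).lt_or_eq
          · rw [hx₀ _ _ _ hq', map_zero]
          · obtain rfl : p' = p := by push_cast at hn; lia
            rw [hx]
            exact hv q'
        · exact hx₁ _ _ _
      · rw [totD_totD]
        rfl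
    · rw [K.total.shape n m hm]
      exact zero_mem _

lemma neg_one_pow_smul_smul {M : Type*} [AddCommGroup M] (q : ℕ) (x : M) :
    ((-1 : ℤ) ^ q) • ((-1 : ℤ) ^ q) • x = x := by
  rw [smul_smul, ← mul_pow, neg_one_mul, neg_neg, one_pow, one_smul]

/-- The graded pieces of the filtration of the total complex: `W` is the row formed by the `q`-th
homology of the columns, as a quotient of the row `Z` of vertical cycles. -/
lemma quot_equiv_homology
    (hi : ∀ p, Function.Injective ((i.f p).hom))
    (hi' : ∀ p x, (∀ q', (K.d q q').f p x = 0) ↔ ∃ z, i.f p z = x)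
    (hρ : ∀ p, Function.Surjective ((ρ.f p).hom))
    (hρ' : ∀ p z, ρ.f p z = 0 ↔ ∃ u, K.vd p q u = i.f p z) :
    Nonempty (K.filtration.quot ((-(q : ℤ) : ℤ) : EInt) ((-(q : ℤ) + 1 : ℤ) : EInt) (-p - q) ≃ₗ[R]
      W.homology p) := by
  have hn : (p + q : ℤ) = -(-p - q) := by ring
  have hiZ : ∀ p k z, i.f k (Z.d p k z) = (K.X q).d p k (i.f p z) := fun p k z =>
    (congrArg (fun f => ModuleCat.Hom.hom f z) (i.comm p k)).symm
  have hρZ : ∀ p k z, ρ.f k (Z.d p k z) = W.d p k (ρ.f p z) := fun p k z =>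
    (congrArg (fun f => ModuleCat.Hom.hom f z) (ρ.comm p k)).symm
  have hcyc : ∀ {n : ℤ} {x : K.Tot n} {p' : ℕ} (h : (p' + q : ℤ) = -n),
      x ∈ K.filtration.sub ((-(q : ℤ) + 1 : ℤ) : EInt) n → ∃ z, i.f p' z = x ⟨(p', q), h⟩ := by
    intro n x p' h hx
    refine (hi' p' _).1 fun q' => ?_
    by_cases hq : q' + 1 = q
    · subst hq
      exact hx.2 p' q' h (by rw [WithBotTop.coe_le_coe]; push_cast; lia)
    · rw [K.shape q q' hq]
      rfl
  let A := K.filtration.cycles ((-(q : ℤ) : ℤ) : EInt) ((-(q : ℤ) + 1 : ℤ) : EInt) (-p - q)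
  let ev : A →ₗ[R] (K.X q).X p := LinearMap.proj
    (⟨(p, q), hn⟩ : {a : ℕ × ℕ // (a.1 + a.2 : ℤ) = -(-p - q)}) ∘ₗ A.subtype
  -- Pairs of a relative cycle and a lift to Z of its component at (p, q). This fibre product maps
  -- onto both sides, and the two maps turn out to have the same kernel.
  let P : Submodule R (A × Z.X p) :=
    LinearMap.eqLocus ((i.f p).hom ∘ₗ LinearMap.snd R A (Z.X p)) (ev ∘ₗ LinearMap.fst R A (Z.X p))
  have hP : ∀ a : P, i.f p a.1.2 = ev a.1.1 := fun a => a.2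
  have h0 : ∀ (a : P) k, W.d p k (((ρ.f p).hom ∘ₗ LinearMap.snd R A (Z.X p) ∘ₗ P.subtype) a) =
      0 := by
    intro a k
    change W.d p k (ρ.f p a.1.2) = 0
    by_cases hk : k + 1 = p
    · subst hk
      rw [← hρZ, hρ', hiZ, hP]
      have h1 := (a.1.1.2.2 (-k - q)).1 k q (by ring)
        (by rw [WithBotTop.coe_le_coe])
      have hd : K.vd k q ((a.1.1.1 : K.Tot _) ⟨(k, q + 1), by push_cast; ring⟩) +
          ((-1 : ℤ) ^ q) • K.hd k q ((a.1.1.1 : K.Tot _) ⟨(k + 1, q), hn⟩) = 0 :=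
        (congrFun (K.total_d_apply _ _ (by push_cast; ring) a.1.1.1) _).symm.trans h1
      -- The (k, q) component of the boundary of a relative cycle vanishes, which expresses the
      -- horizontal boundary of its component at (k + 1, q) as a vertical one.
      refine ⟨-(((-1 : ℤ) ^ q) • (a.1.1.1 : K.Tot _) ⟨(k, q + 1), by push_cast; ring⟩), ?_⟩
      rw [map_neg, map_zsmul, eq_neg_of_add_eq_zero_left hd, smul_neg, neg_neg,
        neg_one_pow_smul_smul]
      rfl
    · rw [W.shape p k hk]
      rfl
  refine ⟨LinearMap.equivOfSurjectiveOfKerEq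
    (Submodule.mkQ _ ∘ₗ LinearMap.fst R A (Z.X p) ∘ₗ P.subtype)
    (W.homologyClass ((ρ.f p).hom ∘ₗ LinearMap.snd R A (Z.X p) ∘ₗ P.subtype) h0)
    ((Submodule.mkQ_surjective _).comp fun a => ?_)
    (W.homologyClass_surjective _ h0 fun w hw => ?_) fun a => ?_⟩
  · obtain ⟨z, hz⟩ := hcyc hn a.2.1
    exact ⟨⟨(a, z), hz⟩, rfl⟩
  · obtain ⟨z, rfl⟩ := hρ p w
    obtain ⟨x, hx, hxz⟩ := exists_mem_cycles (K := K) hn ((hi' p (i.f p z)).2 ⟨z, rfl⟩)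
      (fun k hk => by
        subst hk
        obtain ⟨u, hu⟩ := (hρ' k (Z.d (k + 1) k z)).1 (by rw [hρZ]; exact hw k)
        exact ⟨u, hu.trans (hiZ _ _ _)⟩)
    exact ⟨⟨(⟨x, hx⟩, z), hxz.symm⟩, rfl⟩
  · refine Iff.trans ?_ (W.homologyClass_eq_zero_iff (i := p + 1) (by simp) _ h0 a).symm
    refine (K.filtration.cls_eq_zero_iff (m := -p - q - 1) (sub_add_cancel _ 1)
      a.1.1.2).trans ?_
    have hn' : ((p + 1 : ℕ) + q : ℤ) = -(-p - q - 1) := by push_cast; ring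
    have hn'' : (p + (q + 1 : ℕ) : ℤ) = -(-p - q - 1) := by push_cast; ring
    constructor
    · rintro ⟨y, hy, hxy⟩
      obtain ⟨z', hz'⟩ := hcyc hn' hy
      have h1 := hxy.1 p q hn le_rfl
      have h2 : (a.1.1.1 : K.Tot _) ⟨(p, q), hn⟩ = K.vd p q ((y : K.Tot _) ⟨(p, q + 1), hn''⟩) +
          ((-1 : ℤ) ^ q) • K.hd p q ((y : K.Tot _) ⟨(p + 1, q), hn'⟩) :=
        (sub_eq_zero.1 h1).trans
          (congrFun (K.total_d_apply _ _ (sub_add_cancel _ 1) y) ⟨(p, q), hn⟩)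
      have h3 : ρ.f p (a.1.2 - ((-1 : ℤ) ^ q) • Z.d (p + 1) p z') = 0 := by
        refine (hρ' p _).2 ⟨y ⟨(p, q + 1), hn''⟩, ?_⟩
        rw [map_sub, map_zsmul, hiZ, hz', hP]
        exact (sub_eq_iff_eq_add.2 h2).symm
      refine ⟨((-1 : ℤ) ^ q) • ρ.f (p + 1) z', ?_⟩
      rw [map_sub, map_zsmul, hρZ] at h3
      rw [map_zsmul]
      exact (sub_eq_zero.1 h3).symm
    · rintro ⟨w, hw⟩
      obtain ⟨z', rfl⟩ := hρ (p + 1) w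
      obtain ⟨u, hu⟩ := (hρ' p (a.1.2 - Z.d (p + 1) p z')).1 (by
        rw [map_sub, hρZ]
        exact sub_eq_zero.2 hw.symm)
      rw [map_sub, hiZ, hP] at hu
      -- u accounts for the vertical part and z' for the horizontal part of the component at (p, q).
      -- The factor (-1)^q squares to one in the total differential.
      let y : K.Tot (-p - q - 1) := K.single p (q + 1) hn'' u +
        ((-1 : ℤ) ^ q) • K.single (p + 1) q hn' (i.f (p + 1) z')
      have hy₀ : y ⟨(p, q + 1), hn''⟩ = u := by
        simp only [y, Pi.add_apply, Pi.smul_apply]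
        rw [single_same, single_of_ne _ _ _ _ _ _ (by lia), smul_zero, add_zero]
      have hy₁ : y ⟨(p + 1, q), hn'⟩ = ((-1 : ℤ) ^ q) • i.f (p + 1) z' := by
        simp only [y, Pi.add_apply, Pi.smul_apply]
        rw [single_same, single_of_ne _ _ _ _ _ _ (by lia), zero_add]
      have hy₂ : ∀ p' q' h, q' < q → y ⟨(p', q'), h⟩ = 0 := fun p' q' h hq => by
        simp only [y, Pi.add_apply, Pi.smul_apply]
        rw [single_of_ne _ _ _ _ _ _ (by lia), single_of_ne _ _ _ _ _ _ (by lia), smul_zero,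
          add_zero]
      have hy : y ∈ K.filtration.sub ((-(q : ℤ) + 1 : ℤ) : EInt) (-p - q - 1) := by
        refine ⟨fun p' q' h hb => ?_, fun p' q' h hb => ?_⟩ <;>
          rw [WithBotTop.coe_le_coe] at hb
        · exact hy₂ p' q' h (by omega)
        · obtain hq | rfl := (show q' + 1 ≤ q by omega).lt_or_eq
          · rw [hy₂ _ _ _ hq, map_zero]
          · obtain rfl : p' = p + 1 := by push_cast at h; omega
            rw [hy₁, map_zsmul]
            have h4 : K.vd (p + 1) q' (i.f (p + 1) z') = 0 := (hi' (p + 1) _).2 ⟨z', rfl⟩ q'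
            rw [h4, smul_zero]
      refine ⟨y, hy, ?_⟩
      -- Membership in step -q + 1 gives vanishing of the difference in the rows below q; row q is
      -- settled by the choice of y.
      have hxy := sub_mem a.1.1.2.1 (K.filtration.d_mem hy (-p - q))
      refine K.mem_filtration_of_totD rfl (fun p' q' h hb => ?_) ?_
      · rw [WithBotTop.coe_le_coe] at hb
        obtain hq | rfl := (show q' ≤ q by omega).lt_or_eq
        · exact hxy.1 p' q' h (by rw [WithBotTop.coe_le_coe]; omega)
        · obtain rfl : p' = p := by omega
          refine sub_eq_zero.2 (Eq.trans ?_
            (congrFun (K.total_d_apply _ _ (sub_add_cancel _ 1) y) _).symm)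
          rw [totD_apply, hy₀, hy₁, map_zsmul, neg_one_pow_smul_smul, hu]
          exact (sub_add_cancel _ _).symm
      · have h5 := a.1.1.2.2 (-p - q + 1)
        intro p' q' h hb
        have h6 : K.total.d (-p - q) (-p - q + 1)
            (a.1.1.1 - K.total.d (-p - q - 1) (-p - q) (show K.total.X _ from y)) =
            K.total.d (-p - q) (-p - q + 1) a.1.1.1 := by
          rw [map_sub, CochainComplex.Filtration.d_d_apply, sub_zero]
        exact (congrFun ((K.total_d_apply _ _ rfl _).symm.trans h6) _).trans (h5.1 p' q' h hb)

end DoubleComplex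

namespace ColouredPoset

variable {R : Type r} [Ring R]

/-! ### Exactness of the chains as a functor of the colouring -/

section Colouring

variable (R) (P : Type u) [PartialOrder P] [OrderTop P]

/-- The coloured posets with underlying poset `P`, as a functor of the colouring. -/
@[simps]
def ofColouring : (P ⥤ ModuleCat.{u} R) ⥤ ColouredPoset.{r, u} R where
  obj G := { carrier := P, colour := G }
  map {G G'} α :=
    { toOrderHom := OrderHom.id
      eq_top_iff := fun _ => Iff.rfl
      app := α.app
      naturality := fun h => α.naturality (homOfLE h) }

/-- The chains of `P` as a functor of the colouring. -/
def colouringChains : (P ⥤ ModuleCat.{u} R) ⥤ ChainComplex (ModuleCat.{u} R) ℕ :=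
  ofColouring R P ⋙ chains R

variable {R P} {G G' G'' : P ⥤ ModuleCat.{u} R}

lemma colouringChains_map_f_zero (α : G ⟶ G') : ((colouringChains R P).map α).f 0 = α.app ⊤ :=
  (congrArg (fun k => α.app ⊤ ≫ k) (((ofColouring R P).obj G').res_refl le_top)).trans
    (Category.comp_id _)

lemma colouringChains_map_f_succ (α : G ⟶ G') (n : ℕ) : ((colouringChains R P).map α).f (n + 1) =
    ModuleCat.ofHom (DirectSum.lmap fun s : Fin (n + 1) →o {x : P // x ≠ ⊤} =>
      (α.app (s 0).1).hom) := by
  refine ModuleCat.hom_ext (hom_ext_single fun s v => ?_)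
  refine (simplicesMap_single ((ofColouring R P).map α) s v).trans ?_
  classical
  exact (DirectSum.lmap_lof (fun s : Fin (n + 1) →o {x : P // x ≠ ⊤} =>
    (α.app (s 0).1).hom) s v).symm

/-- In each degree the chains are either the value at 1 or a direct sum of values, so injectivity,
surjectivity and exactness are inherited from the values. -/
lemma colouringChains_map_injective {α : G ⟶ G'} (h : ∀ x, Function.Injective (α.app x)) (n : ℕ) :
    Function.Injective (((colouringChains R P).map α).f n) := by
  cases n with
  | zero => rw [colouringChains_map_f_zero]; exact h ⊤
  | succ n => rw [colouringChains_map_f_succ]; exact (DirectSum.lmap_injective _).2 fun s => h _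

lemma colouringChains_map_surjective {α : G ⟶ G'} (h : ∀ x, Function.Surjective (α.app x)) (n : ℕ) :
    Function.Surjective (((colouringChains R P).map α).f n) := by
  cases n with
  | zero => rw [colouringChains_map_f_zero]; exact h ⊤
  | succ n => rw [colouringChains_map_f_succ]; exact (DirectSum.lmap_surjective _).2 fun s => h _

lemma colouringChains_map_exact {α : G ⟶ G'} {β : G' ⟶ G''}
    (h : ∀ x, Function.Exact (α.app x) (β.app x)) (n : ℕ) :
    Function.Exact (((colouringChains R P).map α).f n) (((colouringChains R P).map β).f n) := by
  cases n with
  | zero => rw [colouringChains_map_f_zero, colouringChains_map_f_zero]; exact h ⊤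
  | succ n =>
    rw [colouringChains_map_f_succ, colouringChains_map_f_succ]
    refine LinearMap.exact_iff.2 ?_
    refine Eq.trans (DirectSum.ker_lmap _) (Eq.trans ?_ (DirectSum.range_lmap _).symm)
    congr 2
    funext s
    exact LinearMap.exact_iff.1 (h _)

instance : (colouringChains R P).PreservesZeroMorphisms where
  map_zero G G' := by
    refine HomologicalComplex.hom_ext _ _ fun n => ?_
    cases n with
    | zero => exact colouringChains_map_f_zero _
    | succ n =>
      rw [colouringChains_map_f_succ]
      exact ModuleCat.hom_ext (LinearMap.ext fun x => DirectSum.ext fun s => rfl)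

end Colouring

/-! ### The double complex of a poset with coefficients in complexes -/

section DoubleComplex

variable {B : Type u} [PartialOrder B] [OrderTop B]

/-- The double complex of a poset with coefficients in complexes. -/
def doubleComplex : (B ⥤ ChainComplex (ModuleCat.{u} R) ℕ) ⥤ DoubleComplex.{r, u} R where
  obj Y :=
    { X := fun q => (colouringChains R B).obj (Y ⋙ HomologicalComplex.eval _ _ q)
      d := fun q q' => (colouringChains R B).map
        { app := fun x => (Y.obj x).d q q'
          naturality := fun _ _ f => (Y.map f).comm q q' }
      shape := fun q q' h => by
        refine Eq.trans ?_ ((colouringChains R B).map_zero _ _)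
        congr 1
        ext x : 2
        exact (Y.obj x).shape q q' h
      d_comp_d' := fun q q' q'' _ _ => by
        rw [← Functor.map_comp]
        refine Eq.trans ?_ ((colouringChains R B).map_zero _ _)
        congr 1
        ext x : 2
        exact (Y.obj x).d_comp_d q q' q'' }
  map {Y Y'} α :=
    { f := fun q => (colouringChains R B).map
        (Functor.whiskerRight α (HomologicalComplex.eval _ _ q))
      comm' := fun q q' _ => by
        rw [← Functor.map_comp, ← Functor.map_comp]
        congr 1
        ext x : 2
        exact (α.app x).comm q q' }
  map_id Y := by
    refine HomologicalComplex.hom_ext _ _ fun q => ?_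
    exact (colouringChains R B).map_id _
  map_comp α β := by
    refine HomologicalComplex.hom_ext _ _ fun q => ?_
    exact (colouringChains R B).map_comp
      (Functor.whiskerRight α (HomologicalComplex.eval _ _ q))
      (Functor.whiskerRight β (HomologicalComplex.eval _ _ q))

/-- Since chains are exact in the colouring, the vertical cycles in row q are the chains with
coefficients in the q-cycles, and their quotient by vertical boundaries is the chains with
coefficients in the q-th homology. -/
lemma quot_equiv_homology (Y : B ⥤ ChainComplex (ModuleCat.{u} R) ℕ) (p q : ℕ) :
    Nonempty ((doubleComplex.obj Y).filtration.quot ((-(q : ℤ) : ℤ) : EInt)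
        ((-(q : ℤ) + 1 : ℤ) : EInt) (-p - q) ≃ₗ[R]
      ((colouringChains R B).obj (Y ⋙ HomologicalComplex.homologyFunctor _ _ q)).homology p) := by
  let i : Y ⋙ HomologicalComplex.cyclesFunctor _ _ q ⟶ Y ⋙ HomologicalComplex.eval _ _ q :=
    { app := fun x => (Y.obj x).iCycles q
      naturality := fun _ _ f => HomologicalComplex.cyclesMap_i _ _ }
  let t : Y ⋙ HomologicalComplex.eval _ _ (q + 1) ⟶ Y ⋙ HomologicalComplex.cyclesFunctor _ _ q :=
    { app := fun x => (Y.obj x).toCycles (q + 1) q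
      naturality := fun x x' f => (cancel_mono ((Y.obj x').iCycles q)).1 (by
        change ((Y.map f).f (q + 1) ≫ (Y.obj x').toCycles (q + 1) q) ≫ (Y.obj x').iCycles q =
          ((Y.obj x).toCycles (q + 1) q ≫ HomologicalComplex.cyclesMap (Y.map f) q) ≫
            (Y.obj x').iCycles q
        simp) }
  let ρ : Y ⋙ HomologicalComplex.cyclesFunctor _ _ q ⟶
      Y ⋙ HomologicalComplex.homologyFunctor _ _ q :=
    Functor.whiskerLeft Y (HomologicalComplex.natTransHomologyπ _ _ q)
  let d : ∀ q', Y ⋙ HomologicalComplex.eval _ _ q ⟶ Y ⋙ HomologicalComplex.eval _ _ q' :=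
    fun q' => { app := fun x => (Y.obj x).d q q'
                naturality := fun _ _ f => (Y.map f).comm q q' }
  have hi : ∀ p, Function.Injective (((colouringChains R B).map i).f p) :=
    colouringChains_map_injective fun x => (ModuleCat.mono_iff_injective _).1
      (inferInstanceAs (Mono ((Y.obj x).iCycles q)))
  have hρ : ∀ p, Function.Surjective (((colouringChains R B).map ρ).f p) :=
    colouringChains_map_surjective fun x => (ModuleCat.epi_iff_surjective _).1
      (inferInstanceAs (Epi ((Y.obj x).homologyπ q)))
  have hid := colouringChains_map_exact (α := i) (β := d ((ComplexShape.down ℕ).next q)) fun x =>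
    (ShortComplex.ShortExact.moduleCat_exact_iff_function_exact _).1
      (ShortComplex.exact_of_f_is_kernel (ShortComplex.mk _ _ ((Y.obj x).iCycles_d q _))
        ((Y.obj x).cyclesIsKernel q _ rfl))
  have htρ := colouringChains_map_exact (α := t) (β := ρ) fun x =>
    (ShortComplex.ShortExact.moduleCat_exact_iff_function_exact _).1
      (ShortComplex.exact_of_g_is_cokernel
        (ShortComplex.mk _ _ ((Y.obj x).toCycles_comp_homologyπ (q + 1) q))
        ((Y.obj x).homologyIsCokernel (q + 1) q (by simp)))
  have hti : ∀ p u, ((colouringChains R B).map i).f p (((colouringChains R B).map t).f p u) =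
      (doubleComplex.obj Y).vd p q u := by
    intro p u
    refine congrArg (fun k => ModuleCat.Hom.hom (HomologicalComplex.Hom.f k p) u)
      (((colouringChains R B).map_comp t i).symm.trans ?_)
    refine congrArg (colouringChains R B).map ?_
    ext x : 2
    exact (Y.obj x).toCycles_i (q + 1) q
  refine DoubleComplex.quot_equiv_homology (i := (colouringChains R B).map i)
    (ρ := (colouringChains R B).map ρ) hi (fun p x => ?_) hρ (fun p z => ?_)
  -- Differentials to indices other than `next q` are zero. For q = 0 there is no related index, and
  -- the differential to `next q` is zero as well.
  · refine Iff.trans ⟨fun h => h _, fun h q' => ?_⟩ (hid p x)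
    by_cases hq : (ComplexShape.down ℕ).Rel q q'
    · obtain rfl := (ComplexShape.down ℕ).next_eq' hq
      exact h
    · rw [(doubleComplex.obj Y).shape q q' hq]
      rfl
  · refine (htρ p z).trans ⟨fun ⟨u, hu⟩ => ⟨u, ?_⟩, fun ⟨u, hu⟩ => ⟨u, hi p ?_⟩⟩
    · rw [← hti, hu]; rfl
    · exact (hti p u).trans hu

end DoubleComplex

end ColouredPoset

/-! ### Dimension shifting -/

namespace CategoryTheory

open Limits

variable {R : Type r} [Ring R]

/-- The connecting homomorphism identifies the homology of the cokernel of a short exact sequence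
of complexes with a kernel, if the homology of the complex in the middle vanishes. -/
lemma ShortComplex.ShortExact.homology_iso_kernel {C : Type*} [Category C] [Abelian C]
    {ι : Type*} {c : ComplexShape ι}
    {S : ShortComplex (HomologicalComplex C c)} (hS : S.ShortExact) {i j : ι} (hij : c.Rel i j)
    (hi : IsZero (S.X₂.homology i)) :
    Nonempty (S.X₃.homology i ≅ kernel (HomologicalComplex.homologyMap S.f j)) := by
  have := hS.mono_δ i j hij hi
  exact ⟨IsLimit.conePointUniqueUpToIso (hS.homology_exact₁ i j hij).fIsKernel
    (limit.isLimit (parallelPair (HomologicalComplex.homologyMap S.f j) 0))⟩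

/-- Comparison of two sequences of homology functors by dimension shifting. -/
lemma homology_iso_of_effaceable {A C : Type*} [Category A] [HasZeroMorphisms A] [Category C]
    [Abelian C] {ι ι' : Type*} {c : ComplexShape ι} {c' : ComplexShape ι'}
    (Q : A ⥤ HomologicalComplex C c) (Q' : A ⥤ HomologicalComplex C c')
    [Q.PreservesZeroMorphisms] [Q'.PreservesZeroMorphisms] (i : ℕ → ι) (i' : ℕ → ι')
    (hi : ∀ n, c.Rel (i (n + 1)) (i n)) (hi' : ∀ n, c'.Rel (i' (n + 1)) (i' n))
    (θ : Q ⋙ HomologicalComplex.homologyFunctor C c (i 0) ≅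
      Q' ⋙ HomologicalComplex.homologyFunctor C c' (i' 0))
    (h : ∀ G : A, ∃ S : ShortComplex A, Nonempty (S.X₃ ≅ G) ∧ (S.map Q).ShortExact ∧
      (S.map Q').ShortExact ∧ (∀ n, IsZero ((Q.obj S.X₂).homology (i (n + 1)))) ∧
      ∀ n, IsZero ((Q'.obj S.X₂).homology (i' (n + 1)))) (n : ℕ) (G : A) :
    Nonempty ((Q.obj G).homology (i n) ≅ (Q'.obj G).homology (i' n)) := by
  induction n generalizing G with
  | zero => exact ⟨θ.app G⟩
  | succ n ih =>
    obtain ⟨S, ⟨e⟩, hQ, hQ', hP, hP'⟩ := h G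
    suffices Nonempty ((Q.obj S.X₃).homology (i (n + 1)) ≅
        (Q'.obj S.X₃).homology (i' (n + 1))) by
      obtain ⟨e'⟩ := this
      exact ⟨(HomologicalComplex.homologyMapIso (Q.mapIso e) _).symm ≪≫ e' ≪≫
        HomologicalComplex.homologyMapIso (Q'.mapIso e) _⟩
    cases n with
    | zero =>
      -- Degree one is the kernel of a map in degree zero; this is the only place where naturality
      -- of `θ` is used.
      obtain ⟨e₁⟩ := hQ.homology_iso_kernel (hi 0) (hP 0)
      obtain ⟨e₂⟩ := hQ'.homology_iso_kernel (hi' 0) (hP' 0)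
      exact ⟨e₁ ≪≫ kernel.mapIso _ _ (θ.app S.X₁) (θ.app S.X₂) (θ.hom.naturality S.f) ≪≫
        e₂.symm⟩
    | succ n =>
      obtain ⟨e'⟩ := ih S.X₁
      -- Here the middle term has no homology in either adjacent degree, so the connecting maps are
      -- isomorphisms and an unnatural isomorphism for `S.X₁` is enough.
      exact ⟨hQ.δIso _ _ (hi (n + 1)) (hP (n + 1)) (hP n) ≪≫ e' ≪≫
        (hQ'.δIso _ _ (hi' (n + 1)) (hP' (n + 1)) (hP' n)).symm⟩

end CategoryTheory

/-! ### Exactness of the total complex -/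

namespace DoubleComplex

variable {R : Type r} [Ring R]

/-- The total complex as a functor. -/
def totalFunctor (R : Type r) [Ring R] :
    DoubleComplex.{r, u} R ⥤ CochainComplex (ModuleCat.{u} R) ℤ where
  obj K := K.total
  map {K L} f :=
    { f := fun n => ModuleCat.ofHom (LinearMap.pi fun a => ((f.f a.1.2).f a.1.1).hom ∘ₗ
        LinearMap.proj a)
      comm' := fun n m h => by
        obtain rfl : n + 1 = m := h
        refine ModuleCat.hom_ext (LinearMap.ext fun x => ?_)
        refine (L.total_d_apply n (n + 1) rfl _).trans (Eq.trans ?_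
          (congrArg (LinearMap.pi fun a => ((f.f a.1.2).f a.1.1).hom ∘ₗ LinearMap.proj a)
            (K.total_d_apply n (n + 1) rfl x)).symm)
        refine Tot.ext fun p q h => ?_
        have h1 : ∀ v, L.vd p q ((f.f (q + 1)).f p v) = (f.f q).f p (K.vd p q v) := fun v =>
          congrArg (fun k => ModuleCat.Hom.hom (HomologicalComplex.Hom.f k p) v)
            (f.comm (q + 1) q)
        have h2 : ∀ v, L.hd p q ((f.f q).f (p + 1) v) = (f.f q).f p (K.hd p q v) := fun v =>
          congrArg (fun k => ModuleCat.Hom.hom k v) ((f.f q).comm (p + 1) p)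
        refine (congrArg₂ (fun a b => a + ((-1 : ℤ) ^ q) • b) (h1 _) (h2 _)).trans ?_
        refine Eq.trans ?_ (congrArg ((f.f q).f p).hom (K.totD_apply n (n + 1) rfl x p q h)).symm
        rw [map_add, map_zsmul]
        rfl }
  map_id _ := rfl
  map_comp _ _ := rfl

instance : (totalFunctor.{r, u} R).PreservesZeroMorphisms where
  map_zero _ _ := rfl

/-- Chains of the total complex are families of components, so preimages are chosen component by
component. -/
lemma total_shortExact {S : ShortComplex (DoubleComplex.{r, u} R)}
    (h : ∀ p q, Function.Injective ((S.f.f q).f p))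
    (h' : ∀ p q, Function.Exact ((S.f.f q).f p) ((S.g.f q).f p))
    (h'' : ∀ p q, Function.Surjective ((S.g.f q).f p)) : (S.map (totalFunctor R)).ShortExact := by
  refine HomologicalComplex.shortExact_of_degreewise_shortExact _ fun n =>
    ModuleCat.shortComplex_shortExact _ ?_ ?_ ?_
  · intro y
    constructor
    · intro hy
      choose x hx using fun a : {a : ℕ × ℕ // (a.1 + a.2 : ℤ) = -n} =>
        (h' a.1.1 a.1.2 _).1 (congrFun hy a)
      exact ⟨x, funext hx⟩
    · rintro ⟨x, rfl⟩
      exact funext fun a => (h' a.1.1 a.1.2 _).2 ⟨_, rfl⟩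
  · exact fun x y hxy => funext fun a => h a.1.1 a.1.2 (congrFun hxy a)
  · intro y
    choose x hx using fun a : {a : ℕ × ℕ // (a.1 + a.2 : ℤ) = -n} => h'' a.1.1 a.1.2 (y a)
    exact ⟨x, funext hx⟩

end DoubleComplex

/-! ### Natural isomorphisms of homology functors -/

namespace HomologicalComplex

variable {R : Type r} [Ring R] {ι : Type*} {c : ComplexShape ι}

lemma homologyMap_homologyClass {C D : HomologicalComplex (ModuleCat.{u} R) c} (f : C ⟶ D)
    {A A' : Type u} [AddCommGroup A] [Module R A] [AddCommGroup A'] [Module R A'] {j : ι}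
    (φ : A →ₗ[R] C.X j) (h : ∀ a k, C.d j k (φ a) = 0) (φ' : A' →ₗ[R] D.X j)
    (h' : ∀ a k, D.d j k (φ' a) = 0) (g : A →ₗ[R] A') (hg : ∀ a, f.f j (φ a) = φ' (g a)) (a : A) :
    homologyMap f j (C.homologyClass φ h a) = D.homologyClass φ' h' (g a) := by
  have h₁ : C.liftCycles (ModuleCat.ofHom φ) _ rfl (by ext a; exact h a _) ≫ cyclesMap f j =
      ModuleCat.ofHom g ≫ D.liftCycles (ModuleCat.ofHom φ') _ rfl (by ext a; exact h' a _) := by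
    rw [← cancel_mono (D.iCycles j)]
    simp only [Category.assoc, cyclesMap_i, liftCycles_i, liftCycles_i_assoc]
    ext a
    exact hg a
  have h₂ : (C.liftCycles (ModuleCat.ofHom φ) _ rfl (by ext a; exact h a _) ≫ C.homologyπ j) ≫
      homologyMap f j = ModuleCat.ofHom g ≫
        D.liftCycles (ModuleCat.ofHom φ') _ rfl (by ext a; exact h' a _) ≫ D.homologyπ j := by
    rw [Category.assoc, homologyπ_naturality, reassoc_of% h₁]
  exact congrArg (fun k => ModuleCat.Hom.hom k a) h₂

/-- Two homology functors are isomorphic if they are quotients of the same functor by the same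
subfunctor. -/
lemma homologyFunctor_iso {A : Type*} [Category A] {ι' : Type*} {c' : ComplexShape ι'}
    {Q : A ⥤ HomologicalComplex (ModuleCat.{u} R) c}
    {Q' : A ⥤ HomologicalComplex (ModuleCat.{u} R) c'} {i j : ι} {i' j' : ι'} (hj : c.prev i = j)
    (hj' : c'.prev i' = j') {F : A ⥤ ModuleCat.{u} R} (α : F ⟶ Q ⋙ eval _ _ i)
    (α' : F ⟶ Q' ⋙ eval _ _ i') (hα : ∀ G, Function.Surjective (α.app G))
    (hα' : ∀ G, Function.Surjective (α'.app G)) (hd : ∀ G k x, (Q.obj G).d i k x = 0)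
    (hd' : ∀ G k x, (Q'.obj G).d i' k x = 0)
    (h : ∀ G v, (∃ x, (Q.obj G).d j i x = α.app G v) ↔ ∃ x, (Q'.obj G).d j' i' x = α'.app G v) :
    Nonempty (Q ⋙ homologyFunctor _ _ i ≅ Q' ⋙ homologyFunctor _ _ i') := by
  let cl (G : A) := (Q.obj G).homologyClass (α.app G).hom fun v k => hd G k _
  let cl' (G : A) := (Q'.obj G).homologyClass (α'.app G).hom fun v k => hd' G k _
  have hcl : ∀ G, Function.Surjective (cl G) := fun G =>
    (Q.obj G).homologyClass_surjective _ _ fun x _ => hα G x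
  have hcl' : ∀ G, Function.Surjective (cl' G) := fun G =>
    (Q'.obj G).homologyClass_surjective _ _ fun x _ => hα' G x
  let e (G : A) := LinearMap.equivOfSurjectiveOfKerEq (cl G) (cl' G) (hcl G) (hcl' G) fun v =>
    ((Q.obj G).homologyClass_eq_zero_iff hj _ _ v).trans
      ((h G v).trans ((Q'.obj G).homologyClass_eq_zero_iff hj' _ _ v).symm)
  have he : ∀ G v, e G (cl G v) = cl' G v := fun G v =>
    LinearMap.equivOfSurjectiveOfKerEq_apply ..
  refine ⟨NatIso.ofComponents (fun G => (e G).toModuleIso) fun {G G'} f => ?_⟩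
  refine ModuleCat.hom_ext (LinearMap.ext fun c => ?_)
  obtain ⟨v, rfl⟩ := hcl G c
  have h₁ : homologyMap (Q.map f) i (cl G v) = cl G' (F.map f v) :=
    homologyMap_homologyClass _ _ _ _ _ (F.map f).hom
      (fun a => (congrArg (fun k => ModuleCat.Hom.hom k a) (α.naturality f)).symm) v
  have h₂ : homologyMap (Q'.map f) i' (cl' G v) = cl' G' (F.map f v) :=
    homologyMap_homologyClass _ _ _ _ _ (F.map f).hom
      (fun a => (congrArg (fun k => ModuleCat.Hom.hom k a) (α'.naturality f)).symm) v
  change e G' (homologyMap (Q.map f) i (cl G v)) = homologyMap (Q'.map f) i' (e G (cl G v))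
  rw [h₁, he, he, h₂]

/-- A complex of modules is exact in a degree where all cycles are boundaries. -/
lemma isZero_homology_of_forall {C : HomologicalComplex (ModuleCat.{u} R) c} {i j k : ι}
    (hi : c.prev j = i) (hk : c.next j = k) (h : ∀ x, C.d j k x = 0 → ∃ y, C.d i j y = x) :
    Limits.IsZero (C.homology j) := by
  subst hi hk
  exact (exactAt_iff_isZero_homology C j).1 ((ShortComplex.moduleCat_exact_iff _).2 h)

end HomologicalComplex

/-! ### Acyclicity of total complexes -/

namespace DoubleComplex

variable {R : Type r} [Ring R] {K : DoubleComplex.{r, u} R}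

/-- `hcol` is exactness of the columns above row zero, and `hrow` is exactness in positive degrees
of the row formed by their zeroth homology. A total cycle is bounded row by row, starting from row
zero. -/
lemma exists_totD_eq
    (hcol : ∀ p q x, K.vd p q x = 0 → ∃ y, K.vd p (q + 1) y = x)
    (hrow : ∀ p x, (∃ y, K.vd p 0 y = K.hd p 0 x) →
      ∃ a b, K.hd (p + 1) 0 a + K.vd (p + 1) 0 b = x) {n : ℕ}
    (hm : (-(n + 2 : ℕ) : ℤ) + 1 = -(n + 1 : ℕ)) (hm' : (-(n + 1 : ℕ) : ℤ) + 1 = -(n : ℕ))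
    (x : K.Tot (-(n + 1 : ℕ))) (hx : K.totD _ _ hm' x = 0) : ∃ y, K.totD _ _ hm y = x := by
  -- The induction makes the boundary of y agree with x in all rows below k; row n + 1 is the last
  -- one in this degree.
  suffices ∀ k : ℕ, ∃ y : K.Tot (-(n + 2 : ℕ)), ∀ p q h, q < k →
      K.totD _ _ hm y ⟨(p, q), h⟩ = x ⟨(p, q), h⟩ by
    obtain ⟨y, hy⟩ := this (n + 2)
    refine ⟨y, Tot.ext fun p q h => hy p q h ?_⟩
    push_cast at h
    omega
  intro k
  induction k with
  | zero => exact ⟨0, fun p q h hq => absurd hq (by omega)⟩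
  | succ k ih =>
    obtain ⟨y, hy⟩ := ih
    by_cases hk : n + 1 < k
    · refine ⟨y, fun p q h _ => hy p q h ?_⟩
      push_cast at h
      omega
    obtain ⟨p, hp⟩ := Nat.exists_eq_add_of_le (not_lt.1 hk)
    have hpk : ((p : ℕ) + (k : ℕ) : ℤ) = -(-(n + 1 : ℕ) : ℤ) := by push_cast; omega
    have hz : K.totD _ _ hm' (x - K.totD _ _ hm y) = 0 := by
      rw [map_sub, totD_totD, sub_zero, hx]
    have hz₀ : ∀ p q h, q < k → (x - K.totD _ _ hm y) ⟨(p, q), h⟩ = 0 :=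
      fun p q h hq => by rw [Pi.sub_apply, hy p q h hq, sub_self]
    -- The correction must fix row k without disturbing the rows below it.
    suffices ∃ y' : K.Tot (-(n + 2 : ℕ)),
        (∀ p q h, q < k → K.totD _ _ hm y' ⟨(p, q), h⟩ = 0) ∧
        K.totD _ _ hm y' ⟨(p, k), hpk⟩ = (x - K.totD _ _ hm y) ⟨(p, k), hpk⟩ by
      obtain ⟨y', h₁, h₂⟩ := this
      refine ⟨y + y', fun p' q h hq => ?_⟩
      rw [map_add, Pi.add_apply]
      obtain hq | rfl := (Nat.lt_succ_iff.1 hq).lt_or_eq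
      · rw [hy _ _ _ hq, h₁ _ _ _ hq, add_zero]
      · obtain rfl : p' = p := by push_cast at h; omega
        rw [h₂, Pi.sub_apply, add_sub_cancel]
    cases k with
    | zero =>
      obtain rfl : p = n + 1 := by omega
      -- In row zero the cycle condition says that the horizontal boundary of the error is a
      -- vertical boundary, as `hrow` requires.
      have h := congrFun hz ⟨(n, 0), by push_cast; omega⟩
      rw [totD_apply, pow_zero, one_smul] at h
      obtain ⟨a, b, hab⟩ := hrow n ((x - K.totD _ _ hm y) ⟨(n + 1, 0), hpk⟩)
        ⟨-(x - K.totD _ _ hm y) ⟨(n, 1), by push_cast; omega⟩, by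
          rw [map_neg]
          exact neg_eq_of_add_eq_zero_right h⟩
      refine ⟨K.single (n + 2) 0 (by push_cast; omega) a +
          K.single (n + 1) 1 (by push_cast; omega) b,
        fun _ _ _ h => absurd h (by omega), ?_⟩
      rw [totD_apply, Pi.add_apply, Pi.add_apply, single_same, single_same,
        single_of_ne _ _ _ _ _ _ (by omega), single_of_ne _ _ _ _ _ _ (by omega)]
      refine Eq.trans ?_ hab
      rw [pow_zero, one_smul]
      refine (add_comm _ _).trans ?_
      exact congrArg₂ (fun a b => K.hd (n + 1) 0 a + K.vd (n + 1) 0 b) (add_zero a) (zero_add b)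
    | succ k =>
      -- In a higher row the error vanishes in the row below, so the cycle condition makes it a
      -- vertical cycle, hence by `hcol` a vertical boundary.
      have h := congrFun hz ⟨(p, k), by push_cast at hpk ⊢; omega⟩
      rw [totD_apply, hz₀ (p + 1) k _ (by omega), map_zero, smul_zero, add_zero] at h
      obtain ⟨b, hb⟩ := hcol _ _ _ h
      refine ⟨K.single p (k + 2) (by push_cast at hpk ⊢; omega) b, fun p' q h' hq => ?_, ?_⟩
      · rw [totD_apply, single_of_ne _ _ _ _ _ _ (by omega), single_of_ne _ _ _ _ _ _ (by omega),
          map_zero, map_zero, smul_zero, add_zero]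
      · rw [totD_apply, single_same, single_of_ne _ _ _ _ _ _ (by omega), map_zero, smul_zero,
          add_zero, hb]

/-- Vanishing of the homology of the total complex of a double complex with exact columns. -/
lemma isZero_homology_total
    (hcol : ∀ p q x, K.vd p q x = 0 → ∃ y, K.vd p (q + 1) y = x)
    (hrow : ∀ p x, (∃ y, K.vd p 0 y = K.hd p 0 x) →
      ∃ a b, K.hd (p + 1) 0 a + K.vd (p + 1) 0 b = x) (n : ℕ) :
    Limits.IsZero (K.total.homology (-(n + 1 : ℕ))) := by
  have hm : (-(n + 2 : ℕ) : ℤ) + 1 = -(n + 1 : ℕ) := by push_cast; ring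
  have hm' : (-(n + 1 : ℕ) : ℤ) + 1 = -(n : ℕ) := by push_cast; ring
  refine HomologicalComplex.isZero_homology_of_forall (i := (-(n + 2 : ℕ) : ℤ))
    (k := (-(n : ℕ) : ℤ))
    ((ComplexShape.up ℤ).prev_eq' hm) ((ComplexShape.up ℤ).next_eq' hm') fun x hx => ?_
  obtain ⟨y, hy⟩ := exists_totD_eq hcol hrow hm hm' x ((K.total_d_apply _ _ hm' x).symm.trans hx)
  exact ⟨y, (K.total_d_apply _ _ hm y).trans hy⟩

end DoubleComplex

/-! ### Degree zero boundaries and direct sum colourings -/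

namespace ColouredPoset

variable {R : Type r} [Ring R]

/-- This presents the zeroth homology as the quotient of the value at 1 by the images of the values
at the elements below 1. -/
lemma exists_chainComplex_d_one_zero_eq_iff (P : ColouredPoset.{r, u} R) (v : P.colour.obj ⊤) :
    (∃ x, P.chainComplex.d 1 0 x = v) ↔
      v ∈ ⨆ z : P.Proper, LinearMap.range (P.res (le_top : z.1 ≤ ⊤)).hom := by
  set N := ⨆ z : P.Proper, LinearMap.range (P.res (le_top : z.1 ≤ ⊤)).hom
  constructor
  · rintro ⟨x, rfl⟩
    have h : N.mkQ ∘ₗ P.augmentation.hom = 0 := hom_ext_single (n := 0) fun s v =>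
      (congrArg N.mkQ (P.augmentation_single s v)).trans
        ((Submodule.Quotient.mk_eq_zero _).2 (Submodule.mem_iSup_of_mem (s 0) ⟨v, rfl⟩))
    exact (Submodule.Quotient.mk_eq_zero _).1 (LinearMap.congr_fun h x)
  · suffices N ≤ LinearMap.range P.augmentation.hom from fun h => this h
    refine iSup_le fun z => ?_
    rintro _ ⟨v, rfl⟩
    exact ⟨P.single (n := 0) ⟨fun _ => z, fun _ _ _ => le_rfl⟩ v,
      P.augmentation_single ⟨fun _ => z, fun _ _ _ => le_rfl⟩ v⟩


open scoped DirectSum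

variable {R : Type r} [Ring R]

/-! ### Colourings by direct sums -/

section Free

variable {P : Type u} [PartialOrder P] {J : Type u} (M : J → ModuleCat.{u} R)

/-- The elements of a direct sum with components in a set of indices. -/
def supported (D : Set J) : Submodule R (⨁ e, M e) where
  carrier := {x | ∀ e, e ∉ D → x e = 0}
  zero_mem' _ _ := rfl
  add_mem' {x y} hx hy e he := by
    rw [DirectSum.add_apply, hx e he, hy e he, add_zero]
  smul_mem' c x hx e he := by
    rw [DirectSum.smul_apply, hx e he, smul_zero]

variable {M} {D D' : Set J}

lemma supported_mono (h : D ⊆ D') : supported M D ≤ supported M D' :=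
  fun _ hx e he => hx e fun he' => he (h he')

open Classical in
lemma lof_mem_supported {e : J} (he : e ∈ D) (m : M e) :
    DirectSum.lof R J (fun e => M e) e m ∈ supported M D := fun _ he' =>
  DirectSum.of_eq_of_ne _ _ _ fun h => he' (h ▸ he)

/-- An element of a direct sum with a single component. -/
def supportedLof (D : Set J) (e : J) (he : e ∈ D) : M e →ₗ[R] supported M D := by
  classical exact
  (DirectSum.lof R J (fun e => M e) e).codRestrict _ (lof_mem_supported he)

open Classical in
lemma supported_sum (x : supported M D) :
    x = ∑ e : (DFinsupp.support x.1 : Finset J), supportedLof D e.1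
      (by_contra fun h => (DFinsupp.mem_support_iff.1 e.2) (x.2 _ h)) (x.1 e.1) := by
  apply Subtype.ext
  rw [AddSubmonoidClass.coe_finsetSum, Finset.univ_eq_attach]
  refine (DirectSum.sum_support_of x.1).symm.trans ?_
  exact (Finset.sum_attach _ (fun e => DirectSum.of (fun e => M e) e (x.1 e))).symm

lemma supported_induction {p : supported M D → Prop} (zero : p 0)
    (add : ∀ x y, p x → p y → p (x + y)) (lof : ∀ e he m, p (supportedLof D e he m))
    (x : supported M D) : p x := by
  classical
  rw [supported_sum x]
  exact Finset.sum_induction _ p add zero fun e _ => lof _ _ _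

lemma supported_hom_ext {N : Type*} [AddCommGroup N] [Module R N] {f g : supported M D →ₗ[R] N}
    (h : ∀ e he m, f (supportedLof D e he m) = g (supportedLof D e he m)) : f = g :=
  LinearMap.ext fun x => supported_induction (p := fun x => f x = g x) (by simp)
    (fun x y hx hy => by rw [map_add, map_add, hx, hy]) h x

/-- The linear map with prescribed values on the summands. -/
def supportedLift {N : Type*} [AddCommGroup N] [Module R N] (f : ∀ e, e ∈ D → M e →ₗ[R] N) :
    supported M D →ₗ[R] N := by
  classical exact
  DirectSum.toModule R J N (fun e => if h : e ∈ D then f e h else 0) ∘ₗ (supported M D).subtype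

@[simp]
lemma supportedLift_lof {N : Type*} [AddCommGroup N] [Module R N]
    (f : ∀ e, e ∈ D → M e →ₗ[R] N) (e : J) (he : e ∈ D) (m : M e) :
    supportedLift f (supportedLof D e he m) = f e he m := by
  classical
  refine (DirectSum.toModule_lof R (φ := fun e => if h : e ∈ D then f e h else 0) e m).trans ?_
  rw [dif_pos he]

variable (M) in
/-- The colouring of a poset by direct sums over an increasing family of sets of indices. -/
@[simps]
def directSumColouring (r : P →o Set J) : P ⥤ ModuleCat.{u} R where
  obj z := ModuleCat.of R (supported M (r z))
  map i := ModuleCat.ofHom (Submodule.inclusion (supported_mono (r.monotone i.le)))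

end Free

/-! ### Acyclicity of direct sums of representable colourings -/

section Contraction

variable {P : Type u} [PartialOrder P] [OrderTop P] {J : Type u} (M : J → ModuleCat.{u} R)
  (r : P →o Set J) (a : J → P)

/-- The sequence `s` preceded by an element below it. -/
def consProper {n : ℕ} (x : P) (s : Fin (n + 1) →o {x : P // x ≠ ⊤}) (hx : x ≤ (s 0).1) :
    Fin (n + 2) →o {x : P // x ≠ ⊤} where
  toFun := Fin.cons ⟨x, fun h => (s 0).2 (top_unique (h ▸ hx))⟩ s
  monotone' := by
    refine Fin.monotone_iff_le_succ.2 fun i => ?_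
    refine Fin.cases ?_ (fun i => ?_) i
    · exact hx
    · exact s.monotone (Fin.castSucc_lt_succ (i := i)).le

-- If e occurs anywhere, it occurs exactly at the elements above `a e`. So the colouring is the
-- direct sum of the colourings represented by the `a e`, with coefficients `M e`.
variable {M r a} (ha : ∀ e z, e ∈ r z → a e ≤ z ∧ e ∈ r (a e))

/-- The coloured poset with the colouring by direct sums. -/
abbrev directSumColoured (M : J → ModuleCat.{u} R) (r : P →o Set J) : ColouredPoset.{r, u} R :=
  (ofColouring R P).obj (directSumColouring M r)

/-- The generators of the chains of a colouring by direct sums. -/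
def directSumSingle {n : ℕ} (s : Fin (n + 1) →o {x : P // x ≠ ⊤}) (e : J) (he : e ∈ r (s 0).1) :
    M e →ₗ[R] (directSumColoured M r).Simplices n :=
  (directSumColoured M r).single s ∘ₗ supportedLof (r (s 0).1) e he

lemma directSumSingle_congr {n : ℕ} {s s' : Fin (n + 1) →o {x : P // x ≠ ⊤}} (h : s = s') {e : J}
    (he : e ∈ r (s 0).1) (m : M e) :
    directSumSingle s e he m = directSumSingle s' e (h ▸ he) m := by
  subst h
  rfl

lemma hom_ext_directSumSingle {n : ℕ} {N : Type u} [AddCommGroup N] [Module R N]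
    {g g' : (directSumColoured M r).Simplices n →ₗ[R] N}
    (h : ∀ s e he m, g (directSumSingle s e he m) = g' (directSumSingle s e he m)) : g = g' :=
  hom_ext_single fun s => LinearMap.congr_fun (supported_hom_ext
    (f := g ∘ₗ (directSumColoured M r).single s) (g := g' ∘ₗ (directSumColoured M r).single s)
    (h s))

lemma operator_directSumSingle {m n : ℕ} (θ : Fin (m + 1) →o Fin (n + 1))
    (s : Fin (n + 1) →o {x : P // x ≠ ⊤}) (e : J) (he : e ∈ r (s 0).1) (v : M e) :
    (directSumColoured M r).operator θ (directSumSingle s e he v) =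
      directSumSingle (s.comp θ) e (r.monotone (s.monotone (Fin.zero_le _)) he) v :=
  (directSumColoured M r).operator_single θ s _

/-- The contracting homotopy of a direct sum of representable colourings, which precedes a sequence
by the representing element. -/
def contraction (n : ℕ) : (directSumColoured M r).Simplices n →ₗ[R]
    (directSumColoured M r).Simplices (n + 1) :=
  (directSumColoured M r).lift fun s => supportedLift fun e he =>
    directSumSingle (consProper (a e) s (ha e _ he).1) e (ha e _ he).2

lemma contraction_directSumSingle {n : ℕ} (s : Fin (n + 1) →o {x : P // x ≠ ⊤}) (e : J)
    (he : e ∈ r (s 0).1) (m : M e) :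
    contraction ha n (directSumSingle s e he m) =
      directSumSingle (consProper (a e) s (ha e _ he).1) e (ha e _ he).2 m :=
  ((directSumColoured M r).lift_single _ s _).trans (supportedLift_lof ..)

/-- The zeroth face drops the element just prepended, and the transition map from `a e` is an
inclusion. With the identities for the other faces this gives dh + hd = id. -/
lemma operator_δ_zero_contraction {n : ℕ} (x : (directSumColoured M r).Simplices n) :
    (directSumColoured M r).operator (SimplexCategory.δ 0).toOrderHom (contraction ha n x) = x := by
  refine LinearMap.congr_fun (hom_ext_directSumSingle (g := (directSumColoured M r).operator
    (SimplexCategory.δ 0).toOrderHom ∘ₗ contraction ha n) (g' := LinearMap.id)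
    fun s e he m => ?_) x
  refine (congrArg _ (contraction_directSumSingle ha s e he m)).trans
    ((operator_directSumSingle _ _ _ _ _).trans (directSumSingle_congr ?_ _ m))
  refine OrderHom.ext _ _ (funext fun j => ?_)
  exact congrArg (consProper (a e) s (ha e _ he).1) (congrFun Fin.succAbove_zero j)

lemma operator_δ_succ_contraction {n : ℕ} (i : Fin (n + 2))
    (x : (directSumColoured M r).Simplices (n + 1)) :
    (directSumColoured M r).operator (SimplexCategory.δ i.succ).toOrderHom
      (contraction ha (n + 1) x) =
    contraction ha n ((directSumColoured M r).operator (SimplexCategory.δ i).toOrderHom x) := by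
  refine LinearMap.congr_fun (hom_ext_directSumSingle
    (g := (directSumColoured M r).operator (SimplexCategory.δ i.succ).toOrderHom ∘ₗ
      contraction ha (n + 1))
    (g' := contraction ha n ∘ₗ (directSumColoured M r).operator (SimplexCategory.δ i).toOrderHom)
    fun s e he m => ?_) x
  refine (congrArg _ (contraction_directSumSingle ha s e he m)).trans
    ((operator_directSumSingle _ _ _ _ _).trans (Eq.trans ?_
      (congrArg (contraction ha n)
        (operator_directSumSingle (SimplexCategory.δ i).toOrderHom s e he m)).symm))
  refine Eq.trans ?_ (contraction_directSumSingle ha _ e _ m).symm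
  refine directSumSingle_congr (OrderHom.ext _ _ (funext fun j => ?_)) _ m
  refine Fin.cases ?_ (fun j => ?_) j
  · exact congrArg (consProper (a e) s (ha e _ he).1) (Fin.succ_succAbove_zero i)
  · exact congrArg (consProper (a e) s (ha e _ he).1) (Fin.succ_succAbove_succ i j)

open Classical in
/-- The contracting homotopy in degree zero. -/
def contractionZero : supported M (r ⊤) →ₗ[R] (directSumColoured M r).Simplices 0 :=
  -- When `a e` is 1 it may not occur in a sequence. Such a summand survives in degree zero homology
  -- and receives the value 0.
  supportedLift fun e he => if h : a e = ⊤ then 0 else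
    directSumSingle ⟨fun _ => ⟨a e, h⟩, fun _ _ _ => le_rfl⟩ e (ha e _ he).2

lemma operator_δ_one_contraction (x : (directSumColoured M r).Simplices 0) :
    (directSumColoured M r).operator (SimplexCategory.δ 1).toOrderHom (contraction ha 0 x) =
      contractionZero ha ((directSumColoured M r).augmentation.hom x) := by
  refine LinearMap.congr_fun (hom_ext_directSumSingle
    (g := (directSumColoured M r).operator (SimplexCategory.δ 1).toOrderHom ∘ₗ contraction ha 0)
    (g' := contractionZero ha ∘ₗ (directSumColoured M r).augmentation.hom) fun s e he m => ?_) x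
  refine (congrArg _ (contraction_directSumSingle ha s e he m)).trans
    ((operator_directSumSingle _ _ _ _ _).trans (Eq.trans ?_
      (congrArg (contractionZero ha) ((directSumColoured M r).augmentation_single s _)).symm))
  refine Eq.trans ?_ (supportedLift_lof _ e (r.monotone le_top he) m).symm
  -- Since `a e` lies below an element different from 1, the default value of `contractionZero` does
  -- not intervene.
  have h : a e ≠ ⊤ := fun h => (s 0).2 (top_unique (h.symm.trans_le (ha e _ he).1))
  refine Eq.trans ?_ (congrArg (fun k : M e →ₗ[R] _ => k m) (dif_neg h)).symm
  refine directSumSingle_congr (OrderHom.ext _ _ (funext fun j => ?_)) _ m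
  obtain rfl := Fin.fin_one_eq_zero j
  rfl

lemma sum_zsmul_ofHom_apply {A A' : Type u} [AddCommGroup A] [Module R A] [AddCommGroup A']
    [Module R A'] {ι : Type*} (s : Finset ι) (c : ι → ℤ) (f : ι → A →ₗ[R] A') (x : A) :
    (∑ i ∈ s, c i • ModuleCat.ofHom (f i)).hom x = ∑ i ∈ s, c i • f i x := by
  rw [ModuleCat.hom_sum, LinearMap.sum_apply]
  rfl

lemma chainComplex_d_succ_apply (P : ColouredPoset.{r, u} R) (n : ℕ) (x : P.Simplices (n + 1)) :
    P.chainComplex.d (n + 2) (n + 1) x =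
      ∑ i : Fin (n + 2), ((-1 : ℤ) ^ (i : ℕ)) • P.operator (SimplexCategory.δ i).toOrderHom x := by
  have h : (P.unaugmented.d (n + 1) n : ModuleCat.of R (P.Simplices (n + 1)) ⟶
      ModuleCat.of R (P.Simplices n)) = ∑ i : Fin (n + 2), ((-1 : ℤ) ^ (i : ℕ)) •
        ModuleCat.ofHom (P.operator (SimplexCategory.δ i).toOrderHom) :=
    AlgebraicTopology.alternatingFaceMapComplex_obj_d _ _
  exact (congrArg (fun k => ModuleCat.Hom.hom k x) h).trans (sum_zsmul_ofHom_apply _ _ _ x)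

/-- A direct sum of representable colourings has no homology in positive degrees. -/
lemma exists_d_eq_of_directSumColoured (ha : ∀ e z, e ∈ r z → a e ≤ z ∧ e ∈ r (a e)) (n : ℕ)
    (x : (directSumColoured M r).Simplices n)
    (hx : (directSumColoured M r).chainComplex.d (n + 1) n x = 0) :
    ∃ y, (directSumColoured M r).chainComplex.d (n + 2) (n + 1) y = x := by
  refine ⟨contraction ha n x, ?_⟩
  refine ((directSumColoured M r).chainComplex_d_succ_apply n _).trans ?_
  -- The zeroth face contributes x. The other faces sum to minus the contraction of the boundary of
  -- x, which is zero.
  rw [Fin.sum_univ_succ, Fin.val_zero, pow_zero, one_smul, operator_δ_zero_contraction]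
  refine (congrArg (fun t => x + t) (?_ : _ = (0 : (directSumColoured M r).Simplices n))).trans
    (add_zero x)
  cases n with
  | zero =>
    rw [Fin.sum_univ_one]
    refine (congrArg _ ((operator_δ_one_contraction ha x).trans
      ((congrArg (contractionZero ha) hx).trans (map_zero _)))).trans (smul_zero _)
  | succ n =>
    replace hx := ((directSumColoured M r).chainComplex_d_succ_apply n x).symm.trans hx
    replace hx := (congrArg (fun t => -contraction ha n t) hx).trans
      ((congrArg _ (map_zero _)).trans neg_zero)
    rw [map_sum, ← Finset.sum_neg_distrib] at hx
    refine (Finset.sum_congr rfl fun i _ => ?_).trans hx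
    rw [operator_δ_succ_contraction, map_zsmul, Fin.val_succ, pow_succ, mul_neg_one, neg_smul]

/-- The boundaries in degree zero for a direct sum of representable colourings. -/
lemma exists_d_one_zero_eq_iff_of_directSumColoured
    (ha : ∀ e z, e ∈ r z → a e ≤ z ∧ e ∈ r (a e)) (v : supported M (r ⊤)) :
    (∃ x, (directSumColoured M r).chainComplex.d 1 0 x = v) ↔ ∀ e, a e = ⊤ → v.1 e = 0 := by
  refine ((directSumColoured M r).exists_chainComplex_d_one_zero_eq_iff v).trans ⟨fun h => ?_,
    fun h => ?_⟩
  · suffices (⨆ z : (directSumColoured M r).Proper,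
        LinearMap.range ((directSumColoured M r).res (le_top : z.1 ≤ ⊤)).hom) ≤
        (supported M {e | a e ≠ ⊤}).comap (supported M (r ⊤)).subtype from
      fun e he => this h e (not_not.2 he)
    refine iSup_le fun z => ?_
    rintro _ ⟨w, rfl⟩ e he
    exact w.2 e fun he' => z.2 (top_unique ((not_not.1 he).symm.trans_le (ha e _ he').1))
  · set N : Submodule R ((directSumColoured M r).colour.obj ⊤) :=
      ⨆ z : (directSumColoured M r).Proper,
        LinearMap.range ((directSumColoured M r).res (le_top : z.1 ≤ ⊤)).hom
    let i : supported M (r ⊤ ∩ {e | a e ≠ ⊤}) →ₗ[R] (directSumColoured M r).colour.obj ⊤ :=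
      Submodule.inclusion (supported_mono Set.inter_subset_left)
    -- An element whose components all have `a e` different from 1 is a sum of generators, each of
    -- which already lives at the proper element `a e`.
    suffices ∀ w, i w ∈ N from
      this ⟨v.1, fun e he => by_contra fun he' => he
        ⟨by_contra fun h' => he' (v.2 e h'), fun h' => he' (h e h')⟩⟩
    refine supported_induction ?_ (fun x y hx hy => ?_) fun e he m => ?_
    · rw [map_zero]
      exact zero_mem _
    · rw [map_add]
      exact add_mem hx hy
    · exact Submodule.mem_iSup_of_mem ⟨a e, he.2⟩ ⟨supportedLof _ e (ha e _ he.1).2 m, rfl⟩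

end Contraction

end ColouredPoset

lemma CategoryTheory.Functor.map_comp_eq_map_comp {P C : Type*} [Preorder P] [Category C]
    (G : P ⥤ C) {a b b' c : P} (f : a ⟶ b) (g : b ⟶ c) (f' : a ⟶ b') (g' : b' ⟶ c) :
    G.map f ≫ G.map g = G.map f' ≫ G.map g' :=
  (G.map_comp f g).symm.trans ((congrArg G.map (Subsingleton.elim _ _)).trans (G.map_comp f' g'))

/-- The colour maps have targets that agree only up to the equality of the underlying maps;
composing with `res` puts them into a common target. -/
lemma ColouredPoset.hom_ext_res {R : Type r} [Ring R] {P Q : ColouredPoset.{r, u} R} {φ ψ : P ⟶ Q}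
    (h : ∀ x, Hom.toOrderHom φ x = Hom.toOrderHom ψ x)
    (h' : ∀ x, Hom.app φ x ≫ Q.res (h x).le = Hom.app ψ x) : φ = ψ := by
  obtain ⟨f, hf, τ, hτ⟩ := φ
  obtain ⟨g, hg, σ, hσ⟩ := ψ
  obtain rfl : f = g := OrderHom.ext _ _ (funext h)
  obtain rfl : τ = σ := funext fun x =>
    ((Category.comp_id _).symm.trans (congrArg (fun k => τ x ≫ k) (Q.res_refl _).symm)).trans (h' x)
  rfl

namespace ColouredPosetBundle

open ColouredPoset Limits

variable {R : Type r} [Ring R] {B : Type u} [PartialOrder B] [OrderTop B]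
  (ξ : ColouredPosetBundle.{r, u} R B)

/-! ### Colourings of the total poset as bundles -/

lemma mk_le_mk (x : B) {y y' : ξ.obj x} (h : y ≤ y') : (⟨x, y⟩ : Total ξ) ≤ ⟨x, y'⟩ :=
  ⟨le_rfl, (ξ.trans_refl_apply le_rfl y).trans_le h⟩

lemma mk_le_mk_map {x z : B} (i : x ⟶ z) (y : ξ.obj x) :
    (⟨x, y⟩ : Total ξ) ≤ ⟨z, Hom.toOrderHom (ξ.map i) y⟩ := ⟨i.le, le_rfl⟩

/-- The inclusion of a fibre into the total poset. -/
def fibreInclusion (x : B) : ξ.obj x →o Total ξ where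
  toFun y := ⟨x, y⟩
  monotone' _ _ h := ξ.mk_le_mk x h

/-- The bundle with the same underlying posets as `ξ` obtained from a colouring of the total
poset. -/
@[simps]
def recolour : (Total ξ ⥤ ModuleCat.{u} R) ⥤ ColouredPosetBundle.{r, u} R B where
  obj G :=
    { obj := fun x => (ofColouring R (ξ.obj x)).obj ((ξ.fibreInclusion x).monotone.functor ⋙ G)
      map := fun {x z} i =>
        { toOrderHom := (Hom.toOrderHom (ξ.map i) : ξ.obj x →o ξ.obj z)
          eq_top_iff := Hom.eq_top_iff (P := ξ.obj x) (Q := ξ.obj z) (ξ.map i)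
          app := fun y => G.map (homOfLE (ξ.mk_le_mk_map i y))
          naturality := fun h => G.map_comp_eq_map_comp _ _ _ _ }
      map_id := fun x => by
        refine hom_ext_res (fun y => ?_) fun y => ?_
        · exact congrArg (fun φ : ξ.obj x ⟶ ξ.obj x => Hom.toOrderHom φ y) (ξ.map_id x)
        · exact (G.map_comp _ _).symm.trans
            ((congrArg G.map (Subsingleton.elim _ (𝟙 _))).trans (G.map_id _))
      map_comp := fun {x y z} i j => by
        refine hom_ext_res (fun w => ?_) fun w => ?_
        · exact congrArg (fun φ : ξ.obj x ⟶ ξ.obj z => Hom.toOrderHom φ w) (ξ.map_comp i j)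
        · exact G.map_comp_eq_map_comp _ _ _ _ }
  map {G G'} α :=
    { app := fun x => (ofColouring R (ξ.obj x)).map
        (Functor.whiskerLeft (ξ.fibreInclusion x).monotone.functor α)
      naturality := fun x z i => by
        refine hom_ext_res (fun y => rfl) fun y => ?_
        refine (congrArg (fun k => (G.map _ ≫ α.app _) ≫ k) (G'.map_id _)).trans
          ((Category.comp_id _).trans ?_)
        exact α.naturality _ }
  map_id G := by
    ext x : 2
    exact (ofColouring R (ξ.obj x)).map_id _
  map_comp α β := by
    ext x : 2
    exact (ofColouring R (ξ.obj x)).map_comp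
      (Functor.whiskerLeft (ξ.fibreInclusion x).monotone.functor α)
      (Functor.whiskerLeft (ξ.fibreInclusion x).monotone.functor β)

lemma total_colour_map_fibre (x : B) {y y' : ξ.obj x} (h : y ≤ y') :
    ξ.total.colour.map (homOfLE (ξ.mk_le_mk x h)) = (ξ.obj x).res h :=
  (Hom.congr_app_res (ξ.trans_refl le_rfl) _).trans (Category.id_comp _)

/-- A bundle is recovered from the colouring of its total poset. -/
def recolourIso : (ξ.recolour).obj ξ.total.colour ≅ ξ :=
  NatIso.ofComponents (fun x =>
    { hom :=
        { toOrderHom := OrderHom.id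
          eq_top_iff := fun _ => Iff.rfl
          app := fun _ => 𝟙 _
          naturality := fun h => (Category.comp_id _).trans
            ((ξ.total_colour_map_fibre x h).trans (Category.id_comp _).symm) }
      inv :=
        { toOrderHom := OrderHom.id
          eq_top_iff := fun _ => Iff.rfl
          app := fun _ => 𝟙 _
          naturality := fun h => (Category.comp_id _).trans
            ((ξ.total_colour_map_fibre x h).symm.trans (Category.id_comp _).symm) }
      hom_inv_id := hom_ext_res (fun _ => rfl) fun y =>
        (congrArg (fun k => 𝟙 _ ≫ k) (ColouredPoset.res_refl _ le_rfl)).trans (Category.comp_id _)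
      inv_hom_id := hom_ext_res (fun _ => rfl) fun y =>
        (congrArg (fun k => 𝟙 _ ≫ k) (ColouredPoset.res_refl _ le_rfl)).trans
          (Category.comp_id _) })
    fun {x z} i => by
      refine hom_ext_res (fun y => ?_) fun y => ?_
      · rfl
      · have h : ξ.total.colour.map (homOfLE (ξ.mk_le_mk_map i y)) =
            Hom.app (P := ξ.obj x) (Q := ξ.obj z) (ξ.map i) y :=
          (congrArg (fun k => Hom.app (P := ξ.obj x) (Q := ξ.obj z) (ξ.map i) y ≫ k)
            (res_refl _ le_rfl)).trans (Category.comp_id _)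
        refine (congrArg (fun k => (ξ.total.colour.map (homOfLE (ξ.mk_le_mk_map i y)) ≫ 𝟙 _) ≫ k)
          ((ξ.obj z).res_refl le_rfl)).trans ((Category.comp_id _).trans ((Category.comp_id _).trans
            (h.trans (Category.id_comp _).symm)))

/-! ### The double complex of a bundle -/

/-- The double complex of the bundle obtained from a colouring of the total poset. -/
def fibreDoubleComplex : (Total ξ ⥤ ModuleCat.{u} R) ⥤ DoubleComplex.{r, u} R :=
  ξ.recolour ⋙ (Functor.whiskeringRight _ _ _).obj (chains R) ⋙ doubleComplex

variable {ξ} {G G' G'' : Total ξ ⥤ ModuleCat.{u} R}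

lemma fibreDoubleComplex_map_injective {α : G ⟶ G'} (h : ∀ x, Function.Injective (α.app x))
    (p q : ℕ) : Function.Injective ((ξ.fibreDoubleComplex.map α).f q |>.f p) :=
  colouringChains_map_injective (fun x => colouringChains_map_injective
    (α := Functor.whiskerLeft (ξ.fibreInclusion x).monotone.functor α) (fun _ => h _) q) p

lemma fibreDoubleComplex_map_surjective {α : G ⟶ G'} (h : ∀ x, Function.Surjective (α.app x))
    (p q : ℕ) : Function.Surjective ((ξ.fibreDoubleComplex.map α).f q |>.f p) :=
  colouringChains_map_surjective (fun x => colouringChains_map_surjective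
    (α := Functor.whiskerLeft (ξ.fibreInclusion x).monotone.functor α) (fun _ => h _) q) p

lemma fibreDoubleComplex_map_exact {α : G ⟶ G'} {β : G' ⟶ G''}
    (h : ∀ x, Function.Exact (α.app x) (β.app x)) (p q : ℕ) :
    Function.Exact ((ξ.fibreDoubleComplex.map α).f q |>.f p)
      ((ξ.fibreDoubleComplex.map β).f q |>.f p) :=
  colouringChains_map_exact (fun x => colouringChains_map_exact
    (α := Functor.whiskerLeft (ξ.fibreInclusion x).monotone.functor α)
    (β := Functor.whiskerLeft (ξ.fibreInclusion x).monotone.functor β) (fun _ => h _) q) p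

instance : ξ.fibreDoubleComplex.PreservesZeroMorphisms where
  map_zero G G' := by
    refine HomologicalComplex.hom_ext _ _ fun q => ?_
    refine Eq.trans (congrArg (colouringChains R B).map ?_) ((colouringChains R B).map_zero _ _)
    ext x : 2
    exact congrArg (fun k => HomologicalComplex.Hom.f k q)
      ((colouringChains R (ξ.obj x)).map_zero ((ξ.fibreInclusion x).monotone.functor ⋙ G)
        ((ξ.fibreInclusion x).monotone.functor ⋙ G'))

end ColouredPosetBundle

namespace ColouredPosetBundle

open ColouredPoset Limits

variable {R : Type r} [Ring R] {B : Type u} [PartialOrder B] [OrderTop B]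
  (ξ : ColouredPosetBundle.{r, u} R B)

/-! ### Comparison in degree zero -/

/-- For x ≠ 1 the map from (x, y) to 1 factors through (x, 1), so only the tops of the other fibres
matter. The two summands are the vertical and the horizontal boundaries in degree zero. -/
lemma iSup_range_eq_sup (G : Total ξ ⥤ ModuleCat.{u} R) :
    (⨆ z : {z : Total ξ // z ≠ ⊤}, LinearMap.range (G.map (homOfLE (le_top : z.1 ≤ ⊤))).hom) =
      (⨆ y : {y : ξ.obj ⊤ // y ≠ ⊤}, LinearMap.range
        (G.map (homOfLE (ξ.mk_le_mk ⊤ (le_top : y.1 ≤ ⊤)))).hom) ⊔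
      ⨆ x : {x : B // x ≠ ⊤}, LinearMap.range
        (G.map (homOfLE (le_top : (⟨x.1, ⊤⟩ : Total ξ) ≤ ⊤))).hom := by
  apply le_antisymm
  · refine iSup_le fun ⟨⟨x, y⟩, hz⟩ => ?_
    by_cases hx : x = ⊤
    · subst hx
      exact le_sup_of_le_left (le_iSup (fun y : {y : ξ.obj ⊤ // y ≠ ⊤} => LinearMap.range
        (G.map (homOfLE (ξ.mk_le_mk ⊤ (le_top : y.1 ≤ ⊤)))).hom) ⟨y, fun h => hz (h ▸ rfl)⟩)
    · refine le_sup_of_le_right (le_iSup_of_le ⟨x, hx⟩ ?_)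
      rintro _ ⟨v, rfl⟩
      refine ⟨G.map (homOfLE (ξ.mk_le_mk x le_top)) v, ?_⟩
      exact congrArg (fun k => ModuleCat.Hom.hom k v) (G.map_comp _ _).symm
  · refine sup_le (iSup_le fun y => ?_) (iSup_le fun x => ?_)
    · exact le_iSup (fun z : {z : Total ξ // z ≠ ⊤} => LinearMap.range
        (G.map (homOfLE (le_top : z.1 ≤ ⊤))).hom) ⟨⟨⊤, y.1⟩, fun h => y.2 (eq_of_heq
          (Total.mk.inj (show Total.mk ⊤ y.1 = Total.mk ⊤ ⊤ from h)).2)⟩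
    · exact le_iSup (fun z : {z : Total ξ // z ≠ ⊤} => LinearMap.range
        (G.map (homOfLE (le_top : z.1 ≤ ⊤))).hom)
        ⟨⟨x.1, ⊤⟩, fun h => x.2 (congrArg Total.base h)⟩

variable {ξ} in
lemma exists_vd_eq_iff (G : Total ξ ⥤ ModuleCat.{u} R) (v : G.obj ⊤) :
    (∃ x, (ξ.fibreDoubleComplex.obj G).vd 0 0 x = v) ↔
      v ∈ ⨆ y : {y : ξ.obj ⊤ // y ≠ ⊤}, LinearMap.range
        (G.map (homOfLE (ξ.mk_le_mk ⊤ (le_top : y.1 ≤ ⊤)))).hom := by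
  refine Iff.trans (exists_congr fun x => ?_)
    (((ξ.recolour.obj G).obj ⊤).exists_chainComplex_d_one_zero_eq_iff v)
  exact Eq.congr_left (congrArg (fun k => ModuleCat.Hom.hom k x) (colouringChains_map_f_zero _))

variable {ξ} in
lemma exists_hd_eq_iff (G : Total ξ ⥤ ModuleCat.{u} R) (v : G.obj ⊤) :
    (∃ x, (ξ.fibreDoubleComplex.obj G).hd 0 0 x = v) ↔
      v ∈ ⨆ x : {x : B // x ≠ ⊤}, LinearMap.range
        (G.map (homOfLE (le_top : (⟨x.1, ⊤⟩ : Total ξ) ≤ ⊤))).hom := by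
  refine (((ofColouring R B).obj ((ξ.recolour.obj G ⋙ chains R) ⋙
    HomologicalComplex.eval _ _ 0)).exists_chainComplex_d_one_zero_eq_iff v).trans ?_
  have : ∀ x : B, (((ofColouring R B).obj ((ξ.recolour.obj G ⋙ chains R) ⋙
      HomologicalComplex.eval _ _ 0)).res (le_top : x ≤ ⊤)) =
      G.map (homOfLE (le_top : (⟨x, ⊤⟩ : Total ξ) ≤ ⊤)) := fun x => (G.map_comp _ _).symm
  refine Eq.to_iff (congrArg (v ∈ ·) ?_)
  exact iSup_congr fun x => congrArg (fun k => LinearMap.range (ModuleCat.Hom.hom k)) (this x.1)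

/-- The total complex of the double complex of a bundle, as a functor of the colouring of the total
poset. -/
abbrev totalComplex : (Total ξ ⥤ ModuleCat.{u} R) ⥤ CochainComplex (ModuleCat.{u} R) ℤ :=
  ξ.fibreDoubleComplex ⋙ DoubleComplex.totalFunctor R

/-- Both functors are quotients of G ↦ G(1), and `iSup_range_eq_sup` shows that the submodules
divided out coincide. -/
lemma homology_zero_iso :
    Nonempty (colouringChains R (Total ξ) ⋙ HomologicalComplex.homologyFunctor _ _ 0 ≅
      ξ.totalComplex ⋙ HomologicalComplex.homologyFunctor _ _ 0) := by
  let F : (Total ξ ⥤ ModuleCat.{u} R) ⥤ ModuleCat.{u} R := (evaluation _ _).obj ⊤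
  let α : F ⟶ colouringChains R (Total ξ) ⋙ HomologicalComplex.eval _ _ 0 :=
    { app := fun G => 𝟙 (G.obj ⊤)
      naturality := fun G G' f => (Category.comp_id _).trans
        ((colouringChains_map_f_zero f).symm.trans (Category.id_comp _).symm) }
  let α' : F ⟶ ξ.totalComplex ⋙ HomologicalComplex.eval _ _ 0 :=
    { app := fun G => ModuleCat.ofHom
        ((ξ.fibreDoubleComplex.obj G).single (n := 0) 0 0 (by simp))
      naturality := fun G G' f => by
        refine ModuleCat.hom_ext (LinearMap.ext fun v => DoubleComplex.Tot.ext fun p q h => ?_)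
        obtain rfl : p = 0 := by push_cast at h; omega
        obtain rfl : q = 0 := by push_cast at h; omega
        refine ((ξ.fibreDoubleComplex.obj G').single_same (n := 0) 0 0 h h (f.app ⊤ v)).trans ?_
        refine Eq.trans ?_ (congrArg ((ξ.fibreDoubleComplex.map f).f 0 |>.f 0).hom
          ((ξ.fibreDoubleComplex.obj G).single_same (n := 0) 0 0 h h v)).symm
        exact congrArg (fun k => ModuleCat.Hom.hom k v) ((colouringChains_map_f_zero
            (Functor.whiskerRight (Functor.whiskerRight (ξ.recolour.map f) (chains R))
              (HomologicalComplex.eval _ _ 0))).trans (colouringChains_map_f_zero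
            (Functor.whiskerLeft (ξ.fibreInclusion ⊤).monotone.functor f))).symm }
  refine HomologicalComplex.homologyFunctor_iso (j := 1) (j' := -1) (by simp)
    ((ComplexShape.up ℤ).prev_eq' (by simp)) α α' (fun G v => ⟨v, rfl⟩) (fun G v => ?_)
    (fun G k x => ?_) (fun G k x => ?_) fun G v => ?_
  · refine ⟨(v : (ξ.fibreDoubleComplex.obj G).Tot 0) ⟨(0, 0), by simp⟩, ?_⟩
    refine DoubleComplex.Tot.ext fun p q h => ?_
    obtain rfl : p = 0 := by push_cast at h; omega
    obtain rfl : q = 0 := by push_cast at h; omega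
    exact DoubleComplex.single_same _ _ _ _ _ _
  · rw [HomologicalComplex.shape _ _ _ (by simp)]
    rfl
  · by_cases hk : (0 : ℤ) + 1 = k
    · refine DoubleComplex.Tot.ext fun p q h => ?_
      push_cast at h
      omega
    · rw [HomologicalComplex.shape _ _ _ hk]
      rfl
  · refine (((ofColouring R (Total ξ)).obj G).exists_chainComplex_d_one_zero_eq_iff v).trans ?_
    refine (Eq.to_iff (congrArg (v ∈ ·) (ξ.iSup_range_eq_sup G))).trans
      (Submodule.mem_sup.trans ?_)
    have hd : ∀ x : (ξ.fibreDoubleComplex.obj G).Tot (-1),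
        ((ξ.fibreDoubleComplex.obj G).total.d (-1) 0 x = α'.app G v) ↔
          (ξ.fibreDoubleComplex.obj G).vd 0 0 (x ⟨(0, 1), by simp⟩) +
          (ξ.fibreDoubleComplex.obj G).hd 0 0 (x ⟨(1, 0), by simp⟩) = v := by
      intro x
      have h₀ := (ξ.fibreDoubleComplex.obj G).total_d_apply (-1) 0 rfl x
      have h₁ : (ξ.fibreDoubleComplex.obj G).totD (-1) 0 rfl x ⟨(0, 0), by simp⟩ =
          (ξ.fibreDoubleComplex.obj G).vd 0 0 (x ⟨(0, 1), by simp⟩) +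
          (ξ.fibreDoubleComplex.obj G).hd 0 0 (x ⟨(1, 0), by simp⟩) := by
        rw [DoubleComplex.totD_apply, pow_zero, one_smul]
      have h₂ := (ξ.fibreDoubleComplex.obj G).single_same (n := 0) 0 0 (by simp) (by simp) v
      refine ⟨fun h => h₁.symm.trans ((congrFun (h₀.symm.trans h) _).trans h₂),
        fun h => h₀.trans (DoubleComplex.Tot.ext fun p q hpq => ?_)⟩
      obtain rfl : p = 0 := by push_cast at hpq; omega
      obtain rfl : q = 0 := by push_cast at hpq; omega
      exact h₁.trans (h.trans h₂.symm)
    constructor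
    · rintro ⟨y, hy, z, hz, hyz⟩
      obtain ⟨a, rfl⟩ := (exists_vd_eq_iff G y).2 hy
      obtain ⟨b, rfl⟩ := (exists_hd_eq_iff G z).2 hz
      refine ⟨(ξ.fibreDoubleComplex.obj G).single (n := -1) 0 1 (by simp) a +
        (ξ.fibreDoubleComplex.obj G).single (n := -1) 1 0 (by simp) b, (hd _).2 ?_⟩
      rw [Pi.add_apply, Pi.add_apply, DoubleComplex.single_same, DoubleComplex.single_same,
        DoubleComplex.single_of_ne _ _ _ _ _ _ (by simp),
        DoubleComplex.single_of_ne _ _ _ _ _ _ (by simp), map_add, map_add, map_zero, map_zero]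
      exact (congrArg₂ (· + ·) (add_zero _) (zero_add _)).trans hyz
    · rintro ⟨x, hx⟩
      exact ⟨_, (exists_vd_eq_iff G _).1 ⟨_, rfl⟩, _, (exists_hd_eq_iff G _).1 ⟨_, rfl⟩,
        (hd x).1 hx⟩

/-! ### Effacement -/

/-- The order ideals generated by the elements of a poset. -/
def principalIdeal (P : Type u) [Preorder P] : P →o Set P where
  toFun := Set.Iic
  monotone' _ _ h := Set.Iic_subset_Iic.2 h

lemma mem_principalIdeal {P : Type u} [Preorder P] {e z : P} : e ∈ principalIdeal P z ↔ e ≤ z :=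
  Iff.rfl

/-- The direct sum of the representable colourings which covers a given colouring. -/
abbrev cover {P : Type u} [PartialOrder P] (G : P ⥤ ModuleCat.{u} R) : P ⥤ ModuleCat.{u} R :=
  directSumColouring (fun e => G.obj e) (principalIdeal P)

/-- The projection of the cover. -/
def coverπ {P : Type u} [PartialOrder P] (G : P ⥤ ModuleCat.{u} R) : cover G ⟶ G where
  app z := ModuleCat.ofHom (supportedLift fun _ he =>
    (G.map (homOfLE (mem_principalIdeal.1 he))).hom)
  naturality z z' i := by
    refine ModuleCat.hom_ext (supported_hom_ext fun e he m => ?_)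
    refine (supportedLift_lof (fun _ he =>
      (G.map (homOfLE (mem_principalIdeal.1 he))).hom) e ((principalIdeal P).monotone i.le he) m).trans
      (Eq.trans ?_
      (congrArg (G.map i).hom (supportedLift_lof (fun _ he =>
        (G.map (homOfLE (mem_principalIdeal.1 he))).hom)
        e he m)).symm)
    exact congrArg (fun k => ModuleCat.Hom.hom k m) 
      (G.map_comp (homOfLE (mem_principalIdeal.1 he)) i)

lemma coverπ_surjective {P : Type u} [PartialOrder P] (G : P ⥤ ModuleCat.{u} R) (z : P) :
    Function.Surjective ((coverπ G).app z) := fun v =>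
  ⟨supportedLof _ z (mem_principalIdeal.2 le_rfl) v,
    (supportedLift_lof _ z (mem_principalIdeal.2 le_rfl) v).trans
    (congrArg (fun k => ModuleCat.Hom.hom k v) (G.map_id z))⟩

/-- The projection of a direct sum to the direct sum over a subset of the indices. -/
def supportedProj {J : Type u} (M : J → ModuleCat.{u} R) (D D' : Set J) :
    supported M D →ₗ[R] supported M D' := by
  classical
  exact LinearMap.codRestrict (supported M D')
    (DFinsupp.filterLinearMap R (fun e => M e) (· ∈ D') ∘ₗ (supported M D).subtype)
    fun x e he => DFinsupp.filter_apply_neg x.1 he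

section

variable {J : Type u} {M : J → ModuleCat.{u} R} {D D' : Set J}

lemma supportedProj_apply_of_mem (x : supported M D) {e : J} (he : e ∈ D') :
    (supportedProj M D D' x).1 e = x.1 e := by
  classical
  exact DFinsupp.filter_apply_pos x.1 he

lemma supportedProj_eq_zero_iff (x : supported M D) :
    supportedProj M D D' x = 0 ↔ ∀ e ∈ D', x.1 e = 0 := by
  refine ⟨fun h e he => ?_, fun h => Subtype.ext (DFinsupp.ext fun e => ?_)⟩
  · rw [← supportedProj_apply_of_mem x he, h]
    rfl
  · by_cases he : e ∈ D'
    · exact (supportedProj_apply_of_mem x he).trans (h e he)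
    · exact (supportedProj M D D' x).2 e he

lemma supportedProj_surjective (h : D' ⊆ D) : Function.Surjective (supportedProj M D D') :=
  fun x => ⟨Submodule.inclusion (supported_mono h) x, Subtype.ext (DFinsupp.ext fun e => by
    by_cases he : e ∈ D'
    · exact supportedProj_apply_of_mem _ he
    · exact ((supportedProj M D D' _).2 e he).trans (x.2 e he).symm)⟩

end

/-- The elements below the greatest element of a fibre. -/
def topIdeal : B →o Set (Total ξ) where
  toFun x := {e | e.base ≤ x ∧ e.pt = ⊤}
  monotone' _ _ h _ he := ⟨he.1.trans h, he.2⟩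

variable {ξ}

/-- This is the condition for `topIdeal` to give a direct sum of representable colourings of B, with
representing elements the base points. -/
lemma base_mem_topIdeal {e : Total ξ} {x : B} (he : e ∈ topIdeal ξ x) :
    e.base ≤ x ∧ e ∈ topIdeal ξ e.base := ⟨he.1, le_rfl, he.2⟩

/-- The projection from the chains of degree zero of the fibres to their homology, for the cover of
a colouring of the total poset. -/
def topProj (G : Total ξ ⥤ ModuleCat.{u} R) :
    (ξ.recolour.obj (cover G) ⋙ chains R) ⋙ HomologicalComplex.eval _ _ 0 ⟶
      directSumColouring (fun e => G.obj e) (topIdeal ξ) where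
  app x := ModuleCat.ofHom (supportedProj (fun e => G.obj e) (principalIdeal (Total ξ) ⟨x, ⊤⟩)
    (topIdeal ξ x))
  naturality x z i := by
    refine ModuleCat.hom_ext (LinearMap.ext fun v => Subtype.ext (DFinsupp.ext fun e => ?_))
    by_cases he : e ∈ topIdeal ξ z
    · refine (supportedProj_apply_of_mem _ he).trans ?_
      by_cases he' : e ∈ topIdeal ξ x
      · exact (supportedProj_apply_of_mem _ he').symm
      -- An index that is new over z has base not below x, so v has no component there.
      · exact (v.2 e fun h => he' ⟨h.1, he.2⟩).trans ((supportedProj _ _ _ v).2 e he').symm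
    · exact ((supportedProj _ _ _ _).2 e he).trans
        ((supportedProj _ _ _ v).2 e fun h => he ((topIdeal ξ).monotone i.le h)).symm

open Classical in
/-- The element of a fibre representing the elements of the fibre above a given element of the
total poset. -/
def transport (x : B) (e : Total ξ) : ξ.obj x :=
  -- The default is harmless: if the base of e is not below x, then e lies below no element of the
  -- fibre over x.
  if h : e.base ≤ x then Hom.toOrderHom (ξ.trans h) e.pt else ⊤

lemma transport_eq {x : B} {e : Total ξ} (h : e.base ≤ x) :
    transport x e = Hom.toOrderHom (ξ.trans h) e.pt := dif_pos h

/-- This rests on the requirement that morphisms of coloured posets send only 1 to 1. It makes the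
surviving indices in the fibres independent of x. -/
lemma transport_eq_top_iff {x : B} {e : Total ξ} (h : e.base ≤ x) :
    transport x e = ⊤ ↔ e.pt = ⊤ := by
  rw [transport_eq h]
  exact Hom.eq_top_iff (ξ.trans h) e.pt

/-- The elements of the total poset below an element of a fibre. -/
abbrev fibreIdeal (x : B) : ξ.obj x →o Set (Total ξ) :=
  (principalIdeal (Total ξ)).comp (ξ.fibreInclusion x)

/-- By the definition of the total order, e lies below (x, y) exactly when its base is below x and
its transport is below y. Hence the cover restricts on every fibre to a direct sum of
representables. -/
lemma transport_mem_fibreIdeal (x : B) (e : Total ξ) (y : ξ.obj x) (he : e ∈ fibreIdeal x y) :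
    transport x e ≤ y ∧ e ∈ fibreIdeal x (transport x e) := by
  obtain ⟨h, h'⟩ := mem_principalIdeal.1 he
  rw [transport_eq (show e.base ≤ x from h)]
  exact ⟨h', h, le_rfl⟩

/-- The boundaries are the elements without components at indices transported to 1, which are the
indices retained by `topProj`. Together with surjectivity this computes the zeroth homology of the
fibre. -/
lemma exact_d_topProj (G : Total ξ ⥤ ModuleCat.{u} R) (x : B) :
    Function.Exact (((ξ.recolour.obj (cover G)).obj x).chainComplex.d 1 0) ((topProj G).app x) := by
  intro v
  refine (supportedProj_eq_zero_iff (M := fun e => G.obj e) v).trans (Iff.trans ?_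
    (exists_d_one_zero_eq_iff_of_directSumColoured (transport_mem_fibreIdeal x) v).symm)
  refine forall_congr' fun e => ⟨fun h h' => ?_, fun h h' => ?_⟩
  · by_cases hx : e.base ≤ x
    · exact h ⟨hx, (transport_eq_top_iff hx).1 h'⟩
    · exact v.2 e fun h'' => hx h''.1
  · exact h ((transport_eq_top_iff h'.1).2 h'.2)

lemma topProj_surjective (G : Total ξ ⥤ ModuleCat.{u} R) (x : B) :
    Function.Surjective ((topProj G).app x) :=
  supportedProj_surjective fun _ he => ⟨he.1, le_top⟩

/-- The double complex of the cover of a colouring has homology only in degree zero. -/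
lemma isZero_homology_totalComplex_cover (G : Total ξ ⥤ ModuleCat.{u} R) (n : ℕ) :
    IsZero ((ξ.totalComplex.obj (cover G)).homology (-(n + 1 : ℕ))) := by
  refine DoubleComplex.isZero_homology_total (fun p q v hv => ?_) (fun p v hv => ?_) n
  · let Y := ξ.recolour.obj (cover G) ⋙ chains R
    let d : ∀ q q', Y ⋙ HomologicalComplex.eval _ _ q ⟶ Y ⋙ HomologicalComplex.eval _ _ q' :=
      fun q q' => { app := fun x => (Y.obj x).d q q'
                    naturality := fun _ _ f => (Y.map f).comm q q' }
    -- Each fibre is acyclic in positive degrees, and the chains of B preserve exactness.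
    refine (colouringChains_map_exact (α := d (q + 2) (q + 1)) (β := d (q + 1) q)
      (fun x => ?_) p v).1 hv
    intro w
    refine ⟨exists_d_eq_of_directSumColoured (transport_mem_fibreIdeal x) q w, ?_⟩
    rintro ⟨w, rfl⟩
    exact congrArg (fun k => ModuleCat.Hom.hom k w) ((Y.obj x).d_comp_d (q + 2) (q + 1) q)
  · let Y := ξ.recolour.obj (cover G) ⋙ chains R
    let d : Y ⋙ HomologicalComplex.eval _ _ 1 ⟶ Y ⋙ HomologicalComplex.eval _ _ 0 :=
      { app := fun x => (Y.obj x).d 1 0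
        naturality := fun _ _ f => (Y.map f).comm 1 0 }
    -- The row of zeroth column homology is the chain complex of B coloured through `topIdeal`,
    -- which is acyclic in positive degrees. A bounding element there lifts to a, and the remaining
    -- error is a vertical boundary.
    have hex := colouringChains_map_exact (α := d) (β := topProj G) (exact_d_topProj G)
    have hsurj := colouringChains_map_surjective (topProj_surjective G)
    let π := (colouringChains R B).map (topProj G)
    have hπ : ∀ p w, (directSumColoured (fun e => G.obj e) (topIdeal ξ)).chainComplex.d (p + 1) p
        (π.f (p + 1) w) = π.f p ((ξ.fibreDoubleComplex.obj (cover G)).hd p 0 w) := fun p w =>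
      congrArg (fun k => ModuleCat.Hom.hom k w) (π.comm (p + 1) p)
    obtain ⟨y, hy⟩ := hv
    obtain ⟨w, hw⟩ := exists_d_eq_of_directSumColoured (fun _ _ => base_mem_topIdeal) p
      (π.f (p + 1) v) ((hπ p v).trans ((hex p _).2 ⟨y, hy⟩))
    obtain ⟨a, rfl⟩ := hsurj (p + 2) w
    obtain ⟨b, hb⟩ := (hex (p + 1) (v - (ξ.fibreDoubleComplex.obj (cover G)).hd (p + 1) 0 a)).1
      ((map_sub (π.f (p + 1)).hom _ _).trans (sub_eq_zero.2 (hw.symm.trans (hπ (p + 1) a))))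
    exact ⟨a, b, (congrArg _ hb).trans (add_sub_cancel _ _)⟩

lemma isZero_homology_colouringChains_cover {P : Type u} [PartialOrder P] [OrderTop P]
    (G : P ⥤ ModuleCat.{u} R) (n : ℕ) :
    IsZero (((colouringChains R P).obj (cover G)).homology (n + 1)) :=
  HomologicalComplex.isZero_homology_of_forall (i := n + 2) (k := n) (by simp) (by simp) fun x hx =>
    exists_d_eq_of_directSumColoured (fun _ _ he => ⟨he, mem_principalIdeal.2 le_rfl⟩) n x hx

variable (ξ) in
/-- The homology of the total poset is the homology of the total complex of the double complex. -/
lemma homology_total_iso (G : Total ξ ⥤ ModuleCat.{u} R) (n : ℕ) :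
    Nonempty (((colouringChains R (Total ξ)).obj G).homology n ≅
      (ξ.totalComplex.obj G).homology (-n)) := by
  obtain ⟨θ⟩ := ξ.homology_zero_iso
  refine homology_iso_of_effaceable (colouringChains R (Total ξ)) ξ.totalComplex id
    (fun n => (-(n : ℤ) : ℤ)) (fun n => rfl) (fun n => by simp) θ
    -- The effacing sequence is the kernel of the cover followed by the cover itself.
    (fun G => ⟨ShortComplex.mk (kernel.ι (coverπ G)) (coverπ G) (kernel.condition _), ⟨Iso.refl _⟩,
      ?_⟩) n G
  have hepi : Epi (coverπ G) := by
    have : ∀ x, Epi ((coverπ G).app x) := fun x =>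
      (ModuleCat.epi_iff_surjective _).2 (coverπ_surjective G x)
    exact NatTrans.epi_of_epi_app _
  have hS : (ShortComplex.mk (kernel.ι (coverπ G)) (coverπ G) (kernel.condition _)).ShortExact :=
    { exact := ShortComplex.exact_kernel _ }
  have hSx := fun x => hS.map_of_exact ((evaluation (Total ξ) (ModuleCat.{u} R)).obj x)
  have hinj : ∀ x, Function.Injective ((kernel.ι (coverπ G)).app x) := fun x =>
    (hSx x).moduleCat_injective_f
  have hexact : ∀ x, Function.Exact ((kernel.ι (coverπ G)).app x) ((coverπ G).app x) := fun x =>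
    (ShortComplex.ShortExact.moduleCat_exact_iff_function_exact _).1 (hSx x).exact
  refine ⟨HomologicalComplex.shortExact_of_degreewise_shortExact _ fun n =>
    ModuleCat.shortComplex_shortExact _ (colouringChains_map_exact hexact n)
      (colouringChains_map_injective hinj n)
      (colouringChains_map_surjective (coverπ_surjective G) n), ?_,
    isZero_homology_colouringChains_cover G, isZero_homology_totalComplex_cover G⟩
  exact DoubleComplex.total_shortExact
    (S := (ShortComplex.mk _ _ (kernel.condition (coverπ G))).map ξ.fibreDoubleComplex)
    (fibreDoubleComplex_map_injective hinj) (fibreDoubleComplex_map_exact hexact)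
    (fibreDoubleComplex_map_surjective (coverπ_surjective G))

end ColouredPosetBundle

/-! ### Assembly of the spectral sequence -/

lemma DoubleComplex.filtration_top {R : Type r} [Ring R] (K : DoubleComplex.{r, u} R) (n : ℤ) :
    K.filtration.sub ⊤ n = ⊤ :=
  K.filtration_of_pos (lt_top_iff_ne_top.2 (by rintro ⟨⟩)) n

/-- The second page of the spectral sequence of the filtered total complex. -/
lemma ColouredPoset.secondPage_iso {R : Type r} [Ring R] {B : Type u} [PartialOrder B] [OrderTop B]
    (Y : B ⥤ ChainComplex (ModuleCat.{u} R) ℕ) (p q : ℕ) :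
    Nonempty (((((doubleComplex.obj Y).filtration.spectralObject.spectralSequence
      Abelian.SpectralObject.coreE₂HomologicalNat).page 2 le_rfl).X (p, q)) ≅
      ((colouringChains R B).obj (Y ⋙ HomologicalComplex.homologyFunctor _ _ q)).homology p) := by
  obtain ⟨e⟩ := quot_equiv_homology Y p q
  exact ⟨(doubleComplex.obj Y).filtration.spectralObject.spectralSequenceFirstPageXIso
    Abelian.SpectralObject.coreE₂HomologicalNat (p, q) ((-(q : ℤ) : ℤ) : EInt)
      ((-(q : ℤ) + 1 : ℤ) : EInt) rfl rfl (-p - q) rfl ≪≫ e.toModuleIso⟩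

lemma ColouredPosetBundle.homology_fibreDoubleComplex_equiv {R : Type r} [Ring R] {B : Type u}
    [PartialOrder B] [OrderTop B] (ξ : ColouredPosetBundle.{r, u} R B) (n : ℕ) :
    Nonempty ((ColouredPoset.doubleComplex.obj (ξ ⋙ ColouredPoset.chains R)).filtration.quot
      ⊥ ⊤ (-n) ≃ₗ[R] (ColouredPoset.homology R n).obj ξ.total) := by
  let K : DoubleComplex.{r, u} R := ColouredPoset.doubleComplex.obj (ξ ⋙ ColouredPoset.chains R)
  obtain ⟨e₁⟩ := K.filtration.quot_equiv_homology K.filtration_bot K.filtration_top (-n)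
  obtain ⟨e₂⟩ := ξ.homology_total_iso ξ.total.colour n
  -- `homology_total_iso` concerns the recoloured bundle, so the double complex of ξ is first
  -- transported along `recolourIso`.
  let e : ξ ⋙ ColouredPoset.chains R ≅ ξ.recolour.obj ξ.total.colour ⋙ ColouredPoset.chains R :=
    Functor.isoWhiskerRight ξ.recolourIso.symm _
  let e₃ := HomologicalComplex.homologyMapIso ((DoubleComplex.totalFunctor R).mapIso
    (ColouredPoset.doubleComplex.mapIso e)) (-n)
  exact ⟨e₁.trans (e₃ ≪≫ e₂.symm).toLinearEquiv⟩

theorem theorem1 {R : Type r} [Ring R] {B : Type u} [PartialOrder B] [OrderTop B] [Finite B]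
    (hB : IsSpeciallyAdmissible B) (ξ : ColouredPosetBundle.{r, u} R B) :
    ∃ E : HomologicalSpectralSequence.{r, u} R,
      (∀ p q : ℕ, Nonempty ((E.page 2 le_rfl).X (p, q) ≅
        (ColouredPoset.homology R p).obj (ξ.fibreHomology q))) ∧
      E.ConvergesTo (fun n => (ColouredPoset.homology R n).obj ξ.total) :=
  let K : DoubleComplex.{r, u} R := ColouredPoset.doubleComplex.obj (ξ ⋙ ColouredPoset.chains R)
  ⟨K.filtration.spectralObject.spectralSequence Abelian.SpectralObject.coreE₂HomologicalNat,
    -- The colouring ξ followed by chains and homology is by definition that of `fibreHomology`.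
    ColouredPoset.secondPage_iso (ξ ⋙ ColouredPoset.chains R),
    K.filtration.spectralObject.convergesTo _ fun n => (ξ.homology_fibreDoubleComplex_equiv n).some⟩

end
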